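/- Let $T>0$, $\Omega=[0,T]\times[0,T]$, $\tfrac1p<\alpha<1$, $0\le\beta\le1$, and let $\psi\in C^1([0,T])$ be increasing with $\psi'(x)\neq0$ for all $x\in[0,T]$. Put $p^*_\alpha=\frac{2p}{2-\alpha p}$ and assume the hypotheses (H): (i) $1<p<2$, $p<q<p^*_\alpha$ and $0\le\mu\in L^\infty(\Omega)$; (ii) $0<\gamma<1$ and $q<r<p^*_\alpha$; (iii) $a\in L^\infty(\Omega)$ and $a(x)>0$ for a.a. $x\in\Omega$. For $\kappa>0$ let $$\mathbf I^{\kappa;\psi}u(x_1,x_2)=\frac1{\Gamma(\kappa)^2}\int_0^{x_1}\!\!\int_0^{x_2}\psi'(s_1)\psi'(s_2)(\psi(x_1)-\psi(s_1))^{\kappa-1}(\psi(x_2)-\psi(s_2))^{\kappa-1}u(s_1,s_2)\,ds_2\,ds_1,$$ let $\mathbf I^{0;\psi}u=u$, and let $$Du=\mathbf I^{\beta(1-\alpha);\psi}\Big(\frac1{\psi'(x_1)\psi'(x_2)}\frac{\partial^2}{\partial x_1\partial x_2}\Big)\mathbf I^{(1-\beta)(1-\alpha);\psi}u$$ be the left-sided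 $\psi$-Hilfer fractional partial derivative in two variables. Let $L^{\mathcal H}(\Omega)$ be the space of measurable $u$ with $\rho(u)=\int_\Omega(|u|^p+\mu(x)|u|^q)\,dx<\infty$, with the norm $\|u\|^{\mathcal H}=\inf\{\tau>0:\rho(u/\tau)\le1\}$. Let $\mathbb H_0$ be the completion of $C_0^\infty(\Omega)$ (smooth functions with compact support in the interior of $\Omega$) with respect to $\|Du\|^{\mathcal H}+\|u\|^{\mathcal H}$, regarded as a space of functions $u\in L^{\mathcal H}(\Omega)$ up to equality almost everywhere, with $D$ extended to $\mathbb H_0$ by continuity. For $\lambda>0$ let $$\mathbf N_\lambda=\Big\{u\in\mathbb H_0\setminus\{0\}:\int_\Omega|Du|^p\,dx+\int_\Omega\mu|Du|^q\,dx=\int_\Omega a|u|^{1-\gamma}\,dx+\lambda\int_\Omega|u|^r\,dx\Big\},$$ $$\mathbf N^0_\lambda=\Big\{u\in\mathbf N_\lambda:(p+\gamma-1)\int_\Omega|Du|^p\,dx+(q+\gamma-1)\int_\Omega\mu|Du|^q\,dx=\lambda(r+\gamma-1)\int_\Omega|u|^r\,dx\Big\}.$$ Then there exists $\lambda^*>0$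 such that $\mathbf N_\lambda^0=\emptyset$ for all $\lambda\in(0,\lambda^*)$. -/

import Mathlib

open MeasureTheory Filter Topology Set
open scoped ENNReal ContDiff

noncomputable section

namespace DoublePhase

/-- The square `Ω = [0,T] × [0,T]`. -/
def square (T : ℝ) : Set (ℝ × ℝ) := Icc 0 T ×ˢ Icc 0 T

/-- Lebesgue measure on `Ω = [0,T] × [0,T]`. -/
def vol (T : ℝ) : Measure (ℝ × ℝ) := volume.restrict (square T)

/-- The fractional critical exponent `p*_α = 2p / (2 - α p)`. -/
def critExp (α p : ℝ) : ℝ := 2 * p / (2 - α * p)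

/-- The left-sided `ψ`-Riemann-Liouville fractional partial integral in two variables, based at the
origin, of order `κ ≥ 0` in each variable; the integral of order `0` is the identity. -/
def fracIntegral (ψ : ℝ → ℝ) (κ : ℝ) (u : ℝ × ℝ → ℝ) (x : ℝ × ℝ) : ℝ :=
  if κ = 0 then u x
  else 1 / (Real.Gamma κ * Real.Gamma κ) *
    ∫ s₁ in (0 : ℝ)..x.1, ∫ s₂ in (0 : ℝ)..x.2,
      deriv ψ s₁ * deriv ψ s₂ * (ψ x.1 - ψ s₁) ^ (κ - 1) * (ψ x.2 - ψ s₂) ^ (κ - 1) * u (s₁, s₂)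

/-- The operator `w ↦ (1 / (ψ'(x₁) ψ'(x₂))) ∂²w / ∂x₁∂x₂`. -/
def mixedDeriv (ψ : ℝ → ℝ) (w : ℝ × ℝ → ℝ) (x : ℝ × ℝ) : ℝ :=
  1 / (deriv ψ x.1 * deriv ψ x.2) * deriv (fun t₁ => deriv (fun t₂ => w (t₁, t₂)) x.2) x.1

/-- The left-sided `ψ`-Hilfer fractional partial derivative in two variables, of order `α` and
type `β`, given by its classical formula. -/
def hilferDeriv (ψ : ℝ → ℝ) (α β : ℝ) (u : ℝ × ℝ → ℝ) : ℝ × ℝ → ℝ :=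
  fracIntegral ψ (β * (1 - α)) (mixedDeriv ψ (fracIntegral ψ ((1 - β) * (1 - α)) u))

/-- The modular `ρ(u) = ∫_Ω (|u|^p + μ(x) |u|^q) dx`, with values in `[0,∞]`. -/
def modular (T p q : ℝ) (μ u : ℝ × ℝ → ℝ) : ℝ≥0∞ :=
  ∫⁻ x, ENNReal.ofReal (|u x| ^ p + μ x * |u x| ^ q) ∂(vol T)

/-- Membership in the Musielak-Orlicz space `L^𝓗(Ω)`. -/
def MemLH (T p q : ℝ) (μ u : ℝ × ℝ → ℝ) : Prop :=
  AEStronglyMeasurable u (vol T) ∧ modular T p q μ u < ⊤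

/-- The Luxemburg norm `inf {τ > 0 : ρ(u / τ) ≤ 1}`, with values in `[0,∞]`. -/
def luxNorm (T p q : ℝ) (μ u : ℝ × ℝ → ℝ) : ℝ≥0∞ :=
  sInf {t : ℝ≥0∞ | ∃ τ : ℝ, 0 < τ ∧ modular T p q μ (fun x => u x / τ) ≤ 1 ∧ t = ENNReal.ofReal τ}

/-- `φ ∈ C_0^∞(Ω)`: smooth with compact support in the open square. -/
def IsTest (T : ℝ) (φ : ℝ × ℝ → ℝ) : Prop :=
  ContDiff ℝ ∞ φ ∧ HasCompactSupport φ ∧ tsupport φ ⊆ Ioo 0 T ×ˢ Ioo 0 T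

/-- `(u, v)` is a limit of pairs `(φ, Dφ)`, `φ ∈ C_0^∞(Ω)` and `D` the `ψ`-Hilfer derivative, for
the norm `‖φ‖ + ‖Dφ‖` (Luxemburg norms). In other words, `u` belongs to the completion of
`C_0^∞(Ω)` for this norm, and `v` is the value at `u` of the extension of `D` by continuity. -/
def HasHilferDeriv (T α β p q : ℝ) (ψ : ℝ → ℝ) (μ u v : ℝ × ℝ → ℝ) : Prop :=
  MemLH T p q μ u ∧ MemLH T p q μ v ∧
  ∃ φ : ℕ → ℝ × ℝ → ℝ, (∀ n, IsTest T (φ n)) ∧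
    Tendsto (fun n => luxNorm T p q μ (fun x => φ n x - u x) +
      luxNorm T p q μ (fun x => hilferDeriv ψ α β (φ n) x - v x)) atTop (𝓝 0)

/-- The space `ℍ^{α,β;ψ}_{𝓗,0}(Ω)`: the completion of `C_0^∞(Ω)` for the norm `‖Du‖ + ‖u‖`,
realised as a space of functions (understood up to equality almost everywhere). -/
def fracSpace (T α β p q : ℝ) (ψ : ℝ → ℝ) (μ : ℝ × ℝ → ℝ) : Set (ℝ × ℝ → ℝ) :=
  {u | ∃ v, HasHilferDeriv T α β p q ψ μ u v}

open Classical in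
/-- The `ψ`-Hilfer derivative on the space `ℍ^{α,β;ψ}_{𝓗,0}(Ω)` (extension by continuity;
determined up to equality almost everywhere). It is `0` by convention outside the space. -/
def hilferD (T α β p q : ℝ) (ψ : ℝ → ℝ) (μ u : ℝ × ℝ → ℝ) : ℝ × ℝ → ℝ :=
  if h : ∃ v, HasHilferDeriv T α β p q ψ μ u v then h.choose else 0

/-- `‖u‖_{L^s(Ω)}^s = ∫_Ω |u|^s dx`. -/
def normPow (T s : ℝ) (u : ℝ × ℝ → ℝ) : ℝ := ∫ x, |u x| ^ s ∂(vol T)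

/-- `∫_Ω w(x) |u|^s dx`; it is `‖u‖_{L^q_μ(Ω)}^q` for `w = μ`, `s = q`. -/
def weightedNormPow (T s : ℝ) (w u : ℝ × ℝ → ℝ) : ℝ := ∫ x, w x * |u x| ^ s ∂(vol T)

/-- The Nehari manifold `N_λ`. -/
def nehari (T α β p q r γ : ℝ) (ψ : ℝ → ℝ) (μ a : ℝ × ℝ → ℝ) (lam : ℝ) : Set (ℝ × ℝ → ℝ) :=
  {u | u ∈ fracSpace T α β p q ψ μ ∧ ¬ (u =ᵐ[vol T] 0) ∧
    normPow T p (hilferD T α β p q ψ μ u) + weightedNormPow T q μ (hilferD T α β p q ψ μ u) =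
      weightedNormPow T (1 - γ) a u + lam * normPow T r u}

/-- The degenerate part `N_λ^0` of the Nehari manifold. -/
def nehariZero (T α β p q r γ : ℝ) (ψ : ℝ → ℝ) (μ a : ℝ × ℝ → ℝ) (lam : ℝ) :
    Set (ℝ × ℝ → ℝ) :=
  {u | u ∈ nehari T α β p q r γ ψ μ a lam ∧
    (p + γ - 1) * normPow T p (hilferD T α β p q ψ μ u) +
      (q + γ - 1) * weightedNormPow T q μ (hilferD T α β p q ψ μ u) =
      lam * (r + γ - 1) * normPow T r u}

end DoublePhase

end

/-! Write P, Q for the two terms in Du, A for the integral of a|u|^(1-γ) and R for that of |u|^r.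
Eliminating λR from the two identities gives (r-p)P + (r-q)Q = (r+γ-1)A, while the second identity
alone gives (p+γ-1)P ≤ λ(r+γ-1)R, because Q ≥ 0. If |u| ≤ c P^(1/p) almost everywhere, then A ≤ C
P^((1-γ)/p) and R ≤ C P^(r/p). The first relation bounds P from above, since 1-γ < p; the second
bounds λ P^((r-p)/p) from below. As r > p and P > 0, λ cannot be arbitrarily small
(`exists_pos_forall_le_parameter`).

The analytic content is thus the embedding into L^∞ (`exists_ae_abs_le`). For a test function φ with
mixed derivative w = mixedDeriv φ, integration gives φ = I^1 w. The semigroup law I^a I^b = I^(a+b)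
and the fundamental theorem of calculus give Dφ = I^(1-α) w for every type β (`hilferDeriv_eq`).
Hence φ = I^α Dφ, and I^α maps L^p to L^∞ by Hölder's inequality, because for α > 1/p its kernel
lies in L^(p') uniformly in the base point (`exists_enorm_rlIntegral_le`). The bound passes to the
completion along an a.e. convergent subsequence.

The integrals I^κ are realised as finite kernels, so that the semigroup law is Tonelli's theorem
plus Euler's Beta integral, and order 0 is the identity kernel. -/

noncomputable section

namespace DoublePhase

open ProbabilityTheory

/-! ### The reparametrisation and Euler's Beta integral -/

/-- The regularity of the reparametrisation `ψ` of `[0,T]` that the fractional calculus uses. -/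
structure IsClock (T : ℝ) (ψ : ℝ → ℝ) : Prop where
  continuousOn : ContinuousOn ψ (Icc 0 T)
  strictMonoOn : StrictMonoOn ψ (Icc 0 T)
  hasDerivAt : ∀ x ∈ Ioo 0 T, HasDerivAt ψ (deriv ψ x) x
  continuousOn_deriv : ContinuousOn (deriv ψ) (Ioo 0 T)
  exists_bounds : ∃ c B : ℝ, 0 < c ∧ 0 < B ∧ ∀ x ∈ Ioo 0 T, c ≤ deriv ψ x ∧ deriv ψ x ≤ B

/-- Outside `[0,T]` the function `ψ` is arbitrary, so `deriv ψ` is meaningful only in the open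
interval. Its bounds come from compactness of the closed interval, applied to the continuous
positive `derivWithin`. -/
lemma isClock_of_contDiffOn {T : ℝ} (hT : 0 < T) {ψ : ℝ → ℝ} (hψ : ContDiffOn ℝ 1 ψ (Icc 0 T))
    (hmono : StrictMonoOn ψ (Icc 0 T))
    (hψ' : ∀ x ∈ Icc 0 T, derivWithin ψ (Icc 0 T) x ≠ 0) : IsClock T ψ := by
  have hd : ∀ x ∈ Ioo 0 T, HasDerivAt ψ (derivWithin ψ (Icc 0 T) x) x := fun x hx =>
    ((hψ.differentiableOn one_ne_zero) x (Ioo_subset_Icc_self hx)).hasDerivWithinAt.hasDerivAt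
      (Icc_mem_nhds hx.1 hx.2)
  have hde : ∀ x ∈ Ioo 0 T, deriv ψ x = derivWithin ψ (Icc 0 T) x := fun x hx => (hd x hx).deriv
  have hc : ContinuousOn (derivWithin ψ (Icc 0 T)) (Icc 0 T) :=
    hψ.continuousOn_derivWithin (uniqueDiffOn_Icc hT) le_rfl
  have hpos : ∀ x ∈ Icc 0 T, 0 < derivWithin ψ (Icc 0 T) x := fun x hx =>
    lt_of_le_of_ne (hmono.monotoneOn.derivWithin_nonneg) (hψ' x hx).symm
  have hne : (Icc 0 T).Nonempty := nonempty_Icc.2 hT.le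
  obtain ⟨m, hm, hm'⟩ := isCompact_Icc.exists_isMinOn hne hc
  obtain ⟨M, hM, hM'⟩ := isCompact_Icc.exists_isMaxOn hne hc
  refine ⟨hψ.continuousOn, hmono, fun x hx => hde x hx ▸ hd x hx,
    (hc.mono Ioo_subset_Icc_self).congr hde, _, _, hpos m hm, hpos M hM, fun x hx => ?_⟩
  rw [hde x hx]
  exact ⟨hm' (Ioo_subset_Icc_self hx), hM' (Ioo_subset_Icc_self hx)⟩

/-- Euler's Beta integral on `(0,1)`. -/
lemma lintegral_beta {a b : ℝ} (ha : 0 < a) (hb : 0 < b) :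
    ∫⁻ z in Ioo (0 : ℝ) 1, ENNReal.ofReal (z ^ (b - 1) * (1 - z) ^ (a - 1)) =
      ENNReal.ofReal (Real.Gamma a * Real.Gamma b / Real.Gamma (a + b)) := by
  have h := lintegral_betaPDF_eq_one hb ha
  have hB := beta_pos hb ha
  rw [lintegral_betaPDF] at h
  have e : ∀ z : ℝ, ENNReal.ofReal (1 / beta b a * z ^ (b - 1) * (1 - z) ^ (a - 1)) =
      ENNReal.ofReal (1 / beta b a) * ENNReal.ofReal (z ^ (b - 1) * (1 - z) ^ (a - 1)) := by
    intro z
    rw [← ENNReal.ofReal_mul (by positivity), mul_assoc]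
  simp_rw [e] at h
  rw [lintegral_const_mul' _ _ ENNReal.ofReal_ne_top] at h
  have h2 := ENNReal.eq_inv_of_mul_eq_one_left ((mul_comm _ _).trans h)
  rw [h2, ← ENNReal.ofReal_inv_of_pos (by positivity)]
  congr 1
  simp only [beta, one_div, inv_inv]
  rw [mul_comm, add_comm]

namespace IsClock

variable {T : ℝ} {ψ : ℝ → ℝ}

lemma deriv_pos (H : IsClock T ψ) {x : ℝ} (hx : x ∈ Ioo 0 T) : 0 < deriv ψ x := by
  obtain ⟨c, B, hc, -, h⟩ := H.exists_bounds
  exact hc.trans_le (h x hx).1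

lemma lt (H : IsClock T ψ) {s x : ℝ} (hs : 0 ≤ s) (hsx : s < x) (hx : x < T) : ψ s < ψ x :=
  H.strictMonoOn ⟨hs, (hsx.trans hx).le⟩ ⟨hs.trans hsx.le, hx.le⟩ hsx

lemma image_Ioo (H : IsClock T ψ) {t x : ℝ} (ht : 0 ≤ t) (htx : t < x) (hx : x < T) :
    ψ '' Ioo t x = Ioo (ψ t) (ψ x) := by
  apply Subset.antisymm
  · rintro _ ⟨s, hs, rfl⟩
    exact ⟨H.lt ht hs.1 (hs.2.trans hx), H.lt (ht.trans hs.1.le) hs.2 hx⟩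
  · exact intermediate_value_Ioo htx.le (H.continuousOn.mono (Icc_subset_Icc ht hx.le))

/-- The Beta integral in the variable `ψ`. -/
lemma lintegral_rpow_mul_rpow (H : IsClock T ψ) {a b : ℝ} (ha : 0 < a) (hb : 0 < b) {t x : ℝ}
    (ht : 0 ≤ t) (htx : t < x) (hx : x < T) :
    ∫⁻ s in Ioo t x, ENNReal.ofReal
        (deriv ψ s * (ψ x - ψ s) ^ (a - 1) * (ψ s - ψ t) ^ (b - 1)) =
      ENNReal.ofReal (Real.Gamma a * Real.Gamma b / Real.Gamma (a + b) *
        (ψ x - ψ t) ^ (a + b - 1)) := by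
  have hl := H.lt ht htx hx
  set l := ψ x - ψ t with hldef
  have hlpos : 0 < l := sub_pos.2 hl
  have himg : (fun s => (ψ s - ψ t) / l) '' Ioo t x = Ioo 0 1 := by
    have : (fun s => (ψ s - ψ t) / l) = (fun y => (y - ψ t) / l) ∘ ψ := rfl
    rw [this, image_comp, H.image_Ioo ht htx hx]
    ext z
    constructor
    · rintro ⟨y, hy, rfl⟩
      exact ⟨div_pos (sub_pos.2 hy.1) hlpos, (div_lt_one hlpos).2 (by linarith [hy.2])⟩
    · intro hz
      refine ⟨ψ t + l * z, ⟨?_, ?_⟩, by simp only; field_simp; ring⟩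
      · nlinarith [hz.1]
      · nlinarith [hz.2]
  have hsub : ∀ s ∈ Ioo t x, s ∈ Ioo 0 T := fun s hs => ⟨ht.trans_lt hs.1, hs.2.trans hx⟩
  -- The substitution z = (ψ s - ψ t) / (ψ x - ψ t) reduces the integral to Euler's.
  have key := lintegral_image_eq_lintegral_abs_deriv_mul (s := Ioo t x)
    (f := fun s => (ψ s - ψ t) / l) (f' := fun s => deriv ψ s / l) measurableSet_Ioo
    (fun s hs => (((H.hasDerivAt s (hsub s hs)).sub_const _).div_const _).hasDerivWithinAt)
    (by
      intro s hs s' hs' h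
      have h' : ψ s = ψ s' := by
        simp only at h
        field_simp at h
        linarith
      exact H.strictMonoOn.injOn (Ioo_subset_Icc_self (hsub s hs))
        (Ioo_subset_Icc_self (hsub s' hs')) h')
    (fun z => ENNReal.ofReal (z ^ (b - 1) * (1 - z) ^ (a - 1)))
  rw [himg, lintegral_beta ha hb] at key
  have e : ∀ s ∈ Ioo t x, ENNReal.ofReal
      (deriv ψ s * (ψ x - ψ s) ^ (a - 1) * (ψ s - ψ t) ^ (b - 1)) =
      ENNReal.ofReal (l ^ (a + b - 1)) * (ENNReal.ofReal |deriv ψ s / l| *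
        ENNReal.ofReal (((ψ s - ψ t) / l) ^ (b - 1) * (1 - (ψ s - ψ t) / l) ^ (a - 1))) := by
    intro s hs
    have h1 : 0 < ψ s - ψ t := sub_pos.2 (H.lt ht hs.1 (hs.2.trans hx))
    have h2 : 0 < ψ x - ψ s := sub_pos.2 (H.lt (ht.trans hs.1.le) hs.2 hx)
    have h3 := H.deriv_pos (hsub s hs)
    rw [← ENNReal.ofReal_mul (abs_nonneg _), ← ENNReal.ofReal_mul (by positivity),
      abs_of_pos (by positivity)]
    have h4 : 1 - (ψ s - ψ t) / l = (ψ x - ψ s) / l := by field_simp; rw [hldef]; ring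
    rw [h4, Real.div_rpow h1.le hlpos.le, Real.div_rpow h2.le hlpos.le,
      show a + b - 1 = 1 + (b - 1) + (a - 1) by ring, Real.rpow_add hlpos, Real.rpow_add hlpos,
      Real.rpow_one]
    congr 1
    field_simp
  rw [setLIntegral_congr_fun measurableSet_Ioo e, lintegral_const_mul' _ _ ENNReal.ofReal_ne_top,
    ← key, ← ENNReal.ofReal_mul (by positivity), mul_comm]

end IsClock

/-! ### One-variable Riemann-Liouville kernels and the semigroup law -/

/-- The Riemann-Liouville density of order `κ` in one variable, with respect to `ψ`. -/
def rlDensity (T : ℝ) (ψ : ℝ → ℝ) (κ x s : ℝ) : ℝ :=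
  {y : ℝ × ℝ | 0 < y.2 ∧ y.2 < y.1 ∧ y.1 < T}.indicator
    (fun y => deriv ψ y.2 * (ψ y.1 - ψ y.2) ^ (κ - 1) / Real.Gamma κ) (x, s)

/-- The one-variable Riemann-Liouville integral of order `κ`, as a kernel. -/
def rlKernel (T : ℝ) (ψ : ℝ → ℝ) (κ : ℝ) : Kernel ℝ ℝ :=
  if κ = 0 then Kernel.id
  else Kernel.withDensity (Kernel.const ℝ volume)
    (fun x s => ENNReal.ofReal (rlDensity T ψ κ x s))

lemma rlDensity_of_mem {T : ℝ} {ψ : ℝ → ℝ} {κ x s : ℝ} (hs : s ∈ Ioo 0 x) (hx : x < T) :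
    rlDensity T ψ κ x s = deriv ψ s * (ψ x - ψ s) ^ (κ - 1) / Real.Gamma κ :=
  indicator_of_mem (s := {y : ℝ × ℝ | 0 < y.2 ∧ y.2 < y.1 ∧ y.1 < T}) (a := (x, s))
    ⟨hs.1, hs.2, hx⟩ _

lemma rlDensity_of_notMem {T : ℝ} {ψ : ℝ → ℝ} {κ x s : ℝ} (h : ¬ (0 < s ∧ s < x ∧ x < T)) :
    rlDensity T ψ κ x s = 0 :=
  indicator_of_notMem (s := {y : ℝ × ℝ | 0 < y.2 ∧ y.2 < y.1 ∧ y.1 < T}) (a := (x, s)) h _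

namespace IsClock

variable {T : ℝ} {ψ : ℝ → ℝ}

lemma rlDensity_nonneg (H : IsClock T ψ) {κ : ℝ} (hκ : 0 < κ) (x s : ℝ) :
    0 ≤ rlDensity T ψ κ x s := by
  by_cases h : 0 < s ∧ s < x ∧ x < T
  · rw [rlDensity_of_mem ⟨h.1, h.2.1⟩ h.2.2]
    have h2 : 0 < ψ x - ψ s := sub_pos.2 (H.lt h.1.le h.2.1 h.2.2)
    have h3 := H.deriv_pos ⟨h.1, h.2.1.trans h.2.2⟩
    have := Real.Gamma_pos_of_pos hκ
    positivity
  · rw [rlDensity_of_notMem h]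

/-- `ψ` need not be measurable on the line. On the triangle supporting the density it agrees with
its truncation to `[0,T]`, which is. -/
lemma measurable_rlDensity (H : IsClock T ψ) (κ : ℝ) :
    Measurable (Function.uncurry (rlDensity T ψ κ)) := by
  classical
  have hψm : Measurable ((Icc 0 T).indicator ψ) := by
    have := H.continuousOn.measurable_piecewise (g := fun _ => (0 : ℝ)) continuousOn_const
      measurableSet_Icc
    rwa [show (Icc 0 T).piecewise ψ (fun _ => 0) = (Icc 0 T).indicator ψ from
      Set.piecewise_eq_indicator] at this
  have hS : MeasurableSet {y : ℝ × ℝ | 0 < y.2 ∧ y.2 < y.1 ∧ y.1 < T} :=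
    (measurableSet_lt measurable_const measurable_snd).inter
      ((measurableSet_lt measurable_snd measurable_fst).inter
        (measurableSet_lt measurable_fst measurable_const))
  have hd : Measurable (deriv ψ) := measurable_deriv ψ
  have hm : Measurable ({y : ℝ × ℝ | 0 < y.2 ∧ y.2 < y.1 ∧ y.1 < T}.indicator
      (fun y => deriv ψ y.2 * ((Icc 0 T).indicator ψ y.1 - (Icc 0 T).indicator ψ y.2) ^ (κ - 1) /
        Real.Gamma κ)) := by
    apply Measurable.indicator _ hS
    exact ((hd.comp measurable_snd).mul (((hψm.comp measurable_fst).sub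
      (hψm.comp measurable_snd)).pow_const _)).div_const _
  convert hm using 1
  change {y : ℝ × ℝ | 0 < y.2 ∧ y.2 < y.1 ∧ y.1 < T}.indicator _ = _
  apply indicator_congr
  rintro ⟨x, s⟩ ⟨h1, h2, h3⟩
  simp only at h1 h2 h3 ⊢
  rw [indicator_of_mem (show x ∈ Icc 0 T from ⟨(h1.trans h2).le, h3.le⟩),
    indicator_of_mem (show s ∈ Icc 0 T from ⟨h1.le, (h2.trans h3).le⟩)]

lemma measurable_ofReal_rlDensity (H : IsClock T ψ) (κ : ℝ) :
    Measurable (Function.uncurry fun x s => ENNReal.ofReal (rlDensity T ψ κ x s)) :=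
  (H.measurable_rlDensity κ).ennreal_ofReal

/-- The mass that the Riemann-Liouville density puts on `(t, x)`. -/
lemma setLIntegral_rlDensity (H : IsClock T ψ) {κ : ℝ} (hκ : 0 < κ) {t x : ℝ} (ht : 0 ≤ t)
    (htx : t < x) (hx : x < T) :
    ∫⁻ s in Ioo t x, ENNReal.ofReal (rlDensity T ψ κ x s) =
      ENNReal.ofReal ((ψ x - ψ t) ^ κ / Real.Gamma (κ + 1)) := by
  have hG := Real.Gamma_pos_of_pos hκ
  have e : ∀ s ∈ Ioo t x, ENNReal.ofReal (rlDensity T ψ κ x s) =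
      ENNReal.ofReal (1 / Real.Gamma κ) * ENNReal.ofReal
        (deriv ψ s * (ψ x - ψ s) ^ (κ - 1) * (ψ s - ψ t) ^ ((1 : ℝ) - 1)) := by
    intro s hs
    rw [rlDensity_of_mem ⟨ht.trans_lt hs.1, hs.2⟩ hx, ← ENNReal.ofReal_mul (by positivity)]
    congr 1
    simp
    ring
  rw [setLIntegral_congr_fun measurableSet_Ioo e, lintegral_const_mul' _ _ ENNReal.ofReal_ne_top,
    H.lintegral_rpow_mul_rpow hκ one_pos ht htx hx, ← ENNReal.ofReal_mul (by positivity)]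
  congr 1
  rw [Real.Gamma_one, add_sub_cancel_right]
  field_simp

/-- The semigroup law for densities: the Gamma factors are normalised so that the Beta integral over
`(t, x)` yields exactly the density of order `a + b`. -/
lemma lintegral_rlDensity_mul_rlDensity (H : IsClock T ψ) {a b : ℝ} (ha : 0 < a) (hb : 0 < b)
    (x t : ℝ) :
    ∫⁻ s, ENNReal.ofReal (rlDensity T ψ a x s) * ENNReal.ofReal (rlDensity T ψ b s t) =
      ENNReal.ofReal (rlDensity T ψ (a + b) x t) := by
  have hGa := Real.Gamma_pos_of_pos ha
  have hGb := Real.Gamma_pos_of_pos hb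
  have hGab := Real.Gamma_pos_of_pos (add_pos ha hb)
  by_cases h : 0 < t ∧ t < x ∧ x < T
  · obtain ⟨ht, htx, hx⟩ := h
    have hd := H.deriv_pos ⟨ht, htx.trans hx⟩
    have e : ∀ s, ENNReal.ofReal (rlDensity T ψ a x s) * ENNReal.ofReal (rlDensity T ψ b s t) =
        (Ioo t x).indicator (fun s => ENNReal.ofReal
          (deriv ψ t / (Real.Gamma a * Real.Gamma b)) * ENNReal.ofReal
          (deriv ψ s * (ψ x - ψ s) ^ (a - 1) * (ψ s - ψ t) ^ (b - 1))) s := by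
      intro s
      by_cases hs : s ∈ Ioo t x
      · have h2 : 0 < ψ x - ψ s := sub_pos.2 (H.lt (ht.trans hs.1).le hs.2 hx)
        have h3 := H.deriv_pos ⟨ht.trans hs.1, hs.2.trans hx⟩
        rw [indicator_of_mem hs, rlDensity_of_mem ⟨ht.trans hs.1, hs.2⟩ hx,
          rlDensity_of_mem ⟨ht, hs.1⟩ (hs.2.trans hx), ← ENNReal.ofReal_mul (by positivity),
          ← ENNReal.ofReal_mul (by positivity)]
        congr 1
        field_simp
      · rw [indicator_of_notMem hs]
        by_cases hs1 : t < s
        · rw [rlDensity_of_notMem (x := x) (s := s) (fun h => hs ⟨hs1, h.2.1⟩)]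
          simp
        · rw [rlDensity_of_notMem (x := s) (s := t) (fun h => hs1 h.2.1)]
          simp
    simp_rw [e]
    rw [lintegral_indicator measurableSet_Ioo, lintegral_const_mul' _ _ ENNReal.ofReal_ne_top,
      H.lintegral_rpow_mul_rpow ha hb ht.le htx hx, ← ENNReal.ofReal_mul (by positivity),
      rlDensity_of_mem ⟨ht, htx⟩ hx]
    congr 1
    field_simp
  · rw [rlDensity_of_notMem h, ENNReal.ofReal_zero, lintegral_eq_zero_iff']
    · refine Eventually.of_forall fun s => ?_
      simp only [Pi.zero_apply]
      by_cases hs : 0 < s ∧ s < x ∧ x < T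
      · rw [rlDensity_of_notMem (x := s) (s := t) (fun h' => h ⟨h'.1, h'.2.1.trans hs.2.1, hs.2.2⟩)]
        simp
      · rw [rlDensity_of_notMem hs]
        simp
    · exact (((H.measurable_ofReal_rlDensity a).comp measurable_prodMk_left).mul
        ((H.measurable_ofReal_rlDensity b).comp measurable_prodMk_right)).aemeasurable

end IsClock

instance (T : ℝ) (ψ : ℝ → ℝ) (κ : ℝ) : IsSFiniteKernel (rlKernel T ψ κ) := by
  unfold rlKernel
  split_ifs
  · infer_instance
  · exact Kernel.IsSFiniteKernel.withDensity _ fun _ _ => ENNReal.ofReal_ne_top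

lemma rlKernel_zero (T : ℝ) (ψ : ℝ → ℝ) : rlKernel T ψ 0 = Kernel.id := if_pos rfl

namespace IsClock

variable {T : ℝ} {ψ : ℝ → ℝ}

lemma rlKernel_apply (H : IsClock T ψ) {κ : ℝ} (hκ : κ ≠ 0) (x : ℝ) :
    rlKernel T ψ κ x = volume.withDensity fun s => ENNReal.ofReal (rlDensity T ψ κ x s) := by
  rw [rlKernel, if_neg hκ, Kernel.withDensity_apply _ (H.measurable_ofReal_rlDensity κ),
    Kernel.const_apply]

lemma rlKernel_comp (H : IsClock T ψ) {a b : ℝ} (ha : 0 ≤ a) (hb : 0 ≤ b) :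
    rlKernel T ψ b ∘ₖ rlKernel T ψ a = rlKernel T ψ (a + b) := by
  rcases ha.eq_or_lt with rfl | ha
  · rw [rlKernel_zero, Kernel.comp_id, zero_add]
  rcases hb.eq_or_lt with rfl | hb
  · rw [rlKernel_zero, Kernel.id_comp, add_zero]
  ext x S hS
  have hma := H.measurable_ofReal_rlDensity a
  have hmb := H.measurable_ofReal_rlDensity b
  rw [Kernel.comp_apply' _ _ _ hS, H.rlKernel_apply ha.ne', H.rlKernel_apply (add_pos ha hb).ne',
    lintegral_withDensity_eq_lintegral_mul _ (f := fun s => ENNReal.ofReal (rlDensity T ψ a x s))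
      (hma.comp measurable_prodMk_left)
      (Kernel.measurable_coe _ hS), withDensity_apply _ hS]
  simp_rw [H.rlKernel_apply hb.ne', withDensity_apply _ hS, Pi.mul_apply]
  simp_rw [← H.lintegral_rlDensity_mul_rlDensity ha hb]
  rw [lintegral_lintegral_swap]
  · refine lintegral_congr fun s => ?_
    rw [lintegral_const_mul' _ _ ENNReal.ofReal_ne_top]
  · exact ((hma.comp (measurable_const.prodMk measurable_snd)).mul
      (hmb.comp (measurable_snd.prodMk measurable_fst))).aemeasurable

lemma rlKernel_apply_univ (H : IsClock T ψ) {κ : ℝ} (hκ : 0 < κ) {x : ℝ} (hx : x ∈ Ioo 0 T) :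
    rlKernel T ψ κ x univ = ENNReal.ofReal ((ψ x - ψ 0) ^ κ / Real.Gamma (κ + 1)) := by
  rw [H.rlKernel_apply hκ.ne', withDensity_apply _ MeasurableSet.univ, setLIntegral_univ,
    ← H.setLIntegral_rlDensity hκ le_rfl hx.1 hx.2, ← lintegral_indicator measurableSet_Ioo]
  refine lintegral_congr fun s => ?_
  by_cases hs : s ∈ Ioo 0 x
  · rw [indicator_of_mem hs]
  · rw [indicator_of_notMem hs, rlDensity_of_notMem fun h => hs ⟨h.1, h.2.1⟩, ENNReal.ofReal_zero]

lemma rlKernel_apply_of_notMem (H : IsClock T ψ) {κ : ℝ} (hκ : κ ≠ 0) {x : ℝ}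
    (hx : x ∉ Ioo 0 T) : rlKernel T ψ κ x = 0 := by
  rw [H.rlKernel_apply hκ]
  have : (fun s => ENNReal.ofReal (rlDensity T ψ κ x s)) = 0 := by
    funext s
    rw [rlDensity_of_notMem fun h => hx ⟨h.1.trans h.2.1, h.2.2⟩, ENNReal.ofReal_zero]
    rfl
  rw [this, withDensity_zero]

lemma isFiniteKernel_rlKernel (H : IsClock T ψ) {κ : ℝ} (hκ : 0 ≤ κ) :
    IsFiniteKernel (rlKernel T ψ κ) := by
  rcases hκ.eq_or_lt with rfl | hκ
  · rw [rlKernel_zero]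
    infer_instance
  refine ⟨ENNReal.ofReal ((ψ T - ψ 0) ^ κ / Real.Gamma (κ + 1)), ENNReal.ofReal_lt_top,
    fun x => ?_⟩
  by_cases hx : x ∈ Ioo 0 T
  · rw [H.rlKernel_apply_univ hκ hx]
    have h0 := H.lt le_rfl hx.1 hx.2
    have h1 : ψ x < ψ T := H.strictMonoOn (Ioo_subset_Icc_self hx)
      ⟨(hx.1.trans hx.2).le, le_rfl⟩ hx.2
    have := Real.Gamma_pos_of_pos (add_pos hκ one_pos)
    gcongr
  · rw [H.rlKernel_apply_of_notMem hκ.ne' hx]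
    simp

end IsClock

/-! ### Riemann-Liouville integrals of bounded functions: Hölder continuity and differentiation -/

/-- Bounded measurable real functions. -/
def BddMeas {α : Type*} [MeasurableSpace α] (f : α → ℝ) : Prop :=
  Measurable f ∧ ∃ C, ∀ x, |f x| ≤ C

namespace BddMeas

variable {α β : Type*} [MeasurableSpace α] [MeasurableSpace β]

lemma comp {f : α → ℝ} (hf : BddMeas f) {g : β → α} (hg : Measurable g) :
    BddMeas fun x => f (g x) :=
  ⟨hf.1.comp hg, hf.2.imp fun _ h x => h (g x)⟩

lemma integrable {f : α → ℝ} (hf : BddMeas f) (m : Measure α) [IsFiniteMeasure m] :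
    Integrable f m :=
  let ⟨C, hC⟩ := hf.2
  Integrable.of_bound hf.1.aestronglyMeasurable C (Eventually.of_forall hC)

lemma integral_kernel_prod {f : α × β → ℝ} (hf : BddMeas f) (k : Kernel α β) [IsFiniteKernel k] :
    BddMeas fun x => ∫ y, f (x, y) ∂(k x) := by
  refine ⟨(hf.1.stronglyMeasurable.integral_kernel_prod_right' (κ := k)).measurable, ?_⟩
  obtain ⟨C, hC⟩ := hf.2
  refine ⟨|C| * k.bound.toReal, fun x => ?_⟩
  rw [← Real.norm_eq_abs]
  refine (norm_integral_le_of_norm_le_const (C := |C|)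
    (Eventually.of_forall fun y => (hC (x, y)).trans (le_abs_self C))).trans ?_
  gcongr
  exact ENNReal.toReal_mono k.bound_ne_top (k.measure_le_bound x univ)

lemma integral_kernel {f : β → ℝ} (hf : BddMeas f) (k : Kernel α β) [IsFiniteKernel k] :
    BddMeas fun x => ∫ y, f y ∂(k x) :=
  (hf.comp measurable_snd).integral_kernel_prod k

end BddMeas

namespace IsClock

variable {T : ℝ} {ψ : ℝ → ℝ}

lemma integral_rlKernel_eq_integral (H : IsClock T ψ) {κ : ℝ} (hκ : 0 < κ) (x : ℝ)
    (f : ℝ → ℝ) : ∫ s, f s ∂(rlKernel T ψ κ x) = ∫ s, rlDensity T ψ κ x s * f s := by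
  rw [H.rlKernel_apply hκ.ne', integral_withDensity_eq_integral_toReal_smul
    (f := fun s => ENNReal.ofReal (rlDensity T ψ κ x s))
    ((H.measurable_ofReal_rlDensity κ).comp measurable_prodMk_left)
    (Eventually.of_forall fun _ => ENNReal.ofReal_lt_top)]
  simp_rw [ENNReal.toReal_ofReal (H.rlDensity_nonneg hκ _ _), smul_eq_mul]

lemma integral_rlKernel (H : IsClock T ψ) {κ : ℝ} (hκ : 0 < κ) {x : ℝ} (hx : x ∈ Ioo 0 T)
    (f : ℝ → ℝ) : ∫ s, f s ∂(rlKernel T ψ κ x) =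
      ∫ s in (0 : ℝ)..x, deriv ψ s * (ψ x - ψ s) ^ (κ - 1) / Real.Gamma κ * f s := by
  rw [H.integral_rlKernel_eq_integral hκ, intervalIntegral.integral_of_le hx.1.le,
    integral_Ioc_eq_integral_Ioo, ← integral_indicator measurableSet_Ioo]
  congr 1
  funext s
  by_cases hs : s ∈ Ioo 0 x
  · rw [indicator_of_mem hs, rlDensity_of_mem hs hx.2]
  · rw [indicator_of_notMem hs, rlDensity_of_notMem fun h => hs ⟨h.1, h.2.1⟩, zero_mul]

lemma integrable_rlDensity (H : IsClock T ψ) {κ : ℝ} (hκ : 0 < κ) (x : ℝ) :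
    Integrable (rlDensity T ψ κ x) := by
  refine ⟨((H.measurable_rlDensity κ).comp measurable_prodMk_left).aestronglyMeasurable, ?_⟩
  rw [hasFiniteIntegral_iff_ofReal (Eventually.of_forall (H.rlDensity_nonneg hκ x))]
  have := H.isFiniteKernel_rlKernel hκ.le
  have h := measure_lt_top (rlKernel T ψ κ x) univ
  rwa [H.rlKernel_apply hκ.ne', withDensity_apply _ MeasurableSet.univ, setLIntegral_univ] at h

lemma integral_rlDensity (H : IsClock T ψ) {κ : ℝ} (hκ : 0 < κ) {x : ℝ} (hx : x ∈ Ioo 0 T) :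
    ∫ s, rlDensity T ψ κ x s = (ψ x - ψ 0) ^ κ / Real.Gamma (κ + 1) := by
  have h := H.rlKernel_apply_univ hκ hx
  have h0 := sub_pos.2 (H.lt le_rfl hx.1 hx.2)
  have := Real.Gamma_pos_of_pos (add_pos hκ one_pos)
  rw [H.rlKernel_apply hκ.ne', withDensity_apply _ MeasurableSet.univ, setLIntegral_univ] at h
  rw [integral_eq_lintegral_of_nonneg_ae (Eventually.of_forall (H.rlDensity_nonneg hκ x))
    (H.integrable_rlDensity hκ x).1, h, ENNReal.toReal_ofReal (by positivity)]

lemma setIntegral_rlDensity (H : IsClock T ψ) {κ : ℝ} (hκ : 0 < κ) {t x : ℝ} (ht : 0 ≤ t)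
    (htx : t < x) (hx : x < T) :
    ∫ s in Ico t x, rlDensity T ψ κ x s = (ψ x - ψ t) ^ κ / Real.Gamma (κ + 1) := by
  have h0 := sub_pos.2 (H.lt ht htx hx)
  have := Real.Gamma_pos_of_pos (add_pos hκ one_pos)
  rw [integral_Ico_eq_integral_Ioo,
    integral_eq_lintegral_of_nonneg_ae (Eventually.of_forall (H.rlDensity_nonneg hκ x))
    (H.integrable_rlDensity hκ x).1.restrict, H.setLIntegral_rlDensity hκ ht htx hx,
    ENNReal.toReal_ofReal (by positivity)]

/-- Riemann-Liouville integrals of order `κ ≤ 1` of bounded functions are `κ`-Hölder continuous in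
the variable `ψ`. -/
lemma abs_integral_rlKernel_sub_le (H : IsClock T ψ) {κ : ℝ} (hκ : 0 < κ) (hκ1 : κ ≤ 1)
    {f : ℝ → ℝ} (hf : Measurable f) {C : ℝ} (hC : ∀ s, |f s| ≤ C) {x y : ℝ} (hx : 0 < x)
    (hxy : x < y) (hy : y < T) :
    |∫ s, f s ∂(rlKernel T ψ κ y) - ∫ s, f s ∂(rlKernel T ψ κ x)| ≤
      2 * C / Real.Gamma (κ + 1) * (ψ y - ψ x) ^ κ := by
  have hG := Real.Gamma_pos_of_pos (add_pos hκ one_pos)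
  have hGκ := Real.Gamma_pos_of_pos hκ
  have hC0 : 0 ≤ C := (abs_nonneg _).trans (hC 0)
  have hix := H.integrable_rlDensity hκ x
  have hiy := H.integrable_rlDensity hκ y
  have hb : ∀ᵐ s : ℝ, ‖f s‖ ≤ C := Eventually.of_forall hC
  have hixf : Integrable fun s => rlDensity T ψ κ x s * f s :=
    hix.mul_bdd hf.aestronglyMeasurable hb
  have hiyf : Integrable fun s => rlDensity T ψ κ y s * f s :=
    hiy.mul_bdd hf.aestronglyMeasurable hb
  rw [H.integral_rlKernel_eq_integral hκ, H.integral_rlKernel_eq_integral hκ,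
    ← integral_sub hiyf hixf]
  have hiI : Integrable ((Ico x y).indicator (rlDensity T ψ κ y)) :=
    hiy.indicator measurableSet_Ico
  have hixy : Integrable fun s => rlDensity T ψ κ x s - rlDensity T ψ κ y s := hix.sub hiy
  -- Since `κ - 1 ≤ 0`, moving the base point from `x` to `y` decreases the density on `(0, x)`, so
  -- there the absolute difference is the reversed difference. On `[x, y)` only the density at `y`
  -- survives, and the doubled indicator corrects the sign.
  have hpt : ∀ s, |rlDensity T ψ κ y s - rlDensity T ψ κ x s| ≤
      rlDensity T ψ κ x s - rlDensity T ψ κ y s +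
        2 * (Ico x y).indicator (rlDensity T ψ κ y) s := by
    intro s
    have hx0 := H.rlDensity_nonneg hκ x s
    have hy0 := H.rlDensity_nonneg hκ y s
    by_cases hs : s ∈ Ico x y
    · rw [indicator_of_mem hs]
      rw [rlDensity_of_notMem (x := x) (s := s) fun h => absurd h.2.1 hs.1.not_gt]
      rw [sub_zero, abs_of_nonneg hy0]
      linarith
    · rw [indicator_of_notMem hs]
      have : rlDensity T ψ κ y s ≤ rlDensity T ψ κ x s := by
        by_cases hs' : s ∈ Ioo 0 x
        · have h1 := sub_pos.2 (H.lt hs'.1.le hs'.2 (hxy.trans hy))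
          have h2 := H.lt hx.le hxy hy
          have h3 := H.deriv_pos ⟨hs'.1, hs'.2.trans (hxy.trans hy)⟩
          rw [rlDensity_of_mem hs' (hxy.trans hy), rlDensity_of_mem ⟨hs'.1, hs'.2.trans hxy⟩ hy]
          gcongr ?_ * ?_ / _
          exact Real.rpow_le_rpow_of_nonpos h1 (by linarith) (by linarith)
        · rw [rlDensity_of_notMem (x := y) (s := s) fun h => ?_]
          · exact hx0
          · rcases lt_or_ge s x with h' | h'
            · exact hs' ⟨h.1, h'⟩
            · exact hs ⟨h', h.2.1⟩
      rw [abs_of_nonpos (by linarith)]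
      linarith
  calc |∫ s, (rlDensity T ψ κ y s * f s - rlDensity T ψ κ x s * f s)|
      ≤ ∫ s, C * (rlDensity T ψ κ x s - rlDensity T ψ κ y s +
        2 * (Ico x y).indicator (rlDensity T ψ κ y) s) := by
        rw [← Real.norm_eq_abs]
        refine norm_integral_le_of_norm_le ((hixy.add (hiI.const_mul 2)).const_mul C)
          (Eventually.of_forall fun s => ?_)
        rw [← sub_mul, Real.norm_eq_abs, abs_mul, mul_comm]
        exact mul_le_mul (hC s) (hpt s) (abs_nonneg _) hC0
    _ = C * ((ψ x - ψ 0) ^ κ / Real.Gamma (κ + 1) - (ψ y - ψ 0) ^ κ / Real.Gamma (κ + 1) +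
        2 * ((ψ y - ψ x) ^ κ / Real.Gamma (κ + 1))) := by
        rw [integral_const_mul, integral_add hixy (hiI.const_mul 2), integral_const_mul,
          integral_indicator measurableSet_Ico, H.setIntegral_rlDensity hκ hx.le hxy hy]
        rw [integral_sub hix hiy, H.integral_rlDensity hκ ⟨hx, hxy.trans hy⟩,
          H.integral_rlDensity hκ ⟨hx.trans hxy, hy⟩]
    -- The total mass increases with the base point, so the first difference is nonpositive.
    _ ≤ C * (0 + 2 * ((ψ y - ψ x) ^ κ / Real.Gamma (κ + 1))) := by
        have h0 := H.lt le_rfl hx (hxy.trans hy)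
        have h1 := H.lt hx.le hxy hy
        gcongr
        rw [sub_nonpos]
        gcongr
    _ = _ := by ring

lemma continuousOn_integral_rlKernel (H : IsClock T ψ) {κ : ℝ} (hκ : 0 < κ) (hκ1 : κ ≤ 1)
    {f : ℝ → ℝ} (hf : BddMeas f) :
    ContinuousOn (fun x => ∫ s, f s ∂(rlKernel T ψ κ x)) (Ioo 0 T) := by
  obtain ⟨hm, C, hC⟩ := hf
  intro x hx
  have hb : ∀ y ∈ Ioo 0 T, |∫ s, f s ∂(rlKernel T ψ κ y) - ∫ s, f s ∂(rlKernel T ψ κ x)| ≤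
      2 * C / Real.Gamma (κ + 1) * |ψ y - ψ x| ^ κ := by
    intro y hy
    rcases lt_trichotomy x y with h | rfl | h
    · rw [abs_of_pos (a := ψ y - ψ x) (sub_pos.2 (H.lt hx.1.le h hy.2))]
      exact H.abs_integral_rlKernel_sub_le hκ hκ1 hm hC hx.1 h hy.2
    · simp [hκ.ne']
    · rw [abs_sub_comm (ψ y), abs_of_pos (a := ψ x - ψ y) (sub_pos.2 (H.lt hy.1.le h hx.2)),
        abs_sub_comm]
      exact H.abs_integral_rlKernel_sub_le hκ hκ1 hm hC hy.1 h hx.2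
  have hψc : ContinuousWithinAt ψ (Ioo 0 T) x := (H.continuousOn.mono Ioo_subset_Icc_self) x hx
  have ht : Tendsto (fun y => 2 * C / Real.Gamma (κ + 1) * |ψ y - ψ x| ^ κ) (𝓝[Ioo 0 T] x)
      (𝓝 0) := by
    have h1 : Tendsto (fun y => |ψ y - ψ x|) (𝓝[Ioo 0 T] x) (𝓝 0) := by
      have := (hψc.tendsto.sub_const (ψ x)).abs
      simpa using this
    have h2 := (h1.rpow_const (p := κ) (Or.inr hκ.le)).const_mul (2 * C / Real.Gamma (κ + 1))
    simpa [Real.zero_rpow hκ.ne'] using h2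
  refine tendsto_iff_norm_sub_tendsto_zero.2 (squeeze_zero' ?_ ?_ ht)
  · exact Eventually.of_forall fun _ => norm_nonneg _
  · filter_upwards [self_mem_nhdsWithin] with y hy using hb y hy

/-- The fundamental theorem of calculus for the Riemann-Liouville integral of order one. -/
lemma hasDerivAt_integral_rlKernel_one (H : IsClock T ψ) {f : ℝ → ℝ} (hf : BddMeas f)
    (hc : ContinuousOn f (Ioo 0 T)) {x : ℝ} (hx : x ∈ Ioo 0 T) :
    HasDerivAt (fun t => ∫ s, f s ∂(rlKernel T ψ 1 t)) (deriv ψ x * f x) x := by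
  have hmeas : Measurable fun s => deriv ψ s * f s := (measurable_deriv ψ).mul hf.1
  have hint : IntervalIntegrable (fun s => deriv ψ s * f s) volume 0 x := by
    obtain ⟨c, B, hc, hB, hcB⟩ := H.exists_bounds
    obtain ⟨C, hC⟩ := hf.2
    rw [intervalIntegrable_iff_integrableOn_Ioc_of_le hx.1.le]
    refine Measure.integrableOn_of_bounded (M := B * C) (by simp) hmeas.aestronglyMeasurable ?_
    refine (ae_restrict_mem measurableSet_Ioc).mono fun s hs => ?_
    have h1 : s ∈ Ioo 0 T := ⟨hs.1, hs.2.trans_lt hx.2⟩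
    rw [norm_mul, Real.norm_eq_abs, Real.norm_eq_abs, abs_of_pos (H.deriv_pos h1)]
    exact mul_le_mul (hcB s h1).2 (hC s) (abs_nonneg _) hB.le
  have hnhds : Ioo 0 T ∈ 𝓝 x := Ioo_mem_nhds hx.1 hx.2
  have key := intervalIntegral.integral_hasDerivAt_right hint
    (hmeas.stronglyMeasurable.stronglyMeasurableAtFilter)
    ((H.continuousOn_deriv.continuousAt hnhds).mul (hc.continuousAt hnhds))
  refine key.congr_of_eventuallyEq ?_
  filter_upwards [hnhds] with t ht
  rw [H.integral_rlKernel one_pos ht]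
  simp

end IsClock

/-! ### The two-variable integral and its mixed derivative -/

/-- The two-variable Riemann-Liouville integral of order `κ`, as a kernel. -/
def rlKernel₂ (T : ℝ) (ψ : ℝ → ℝ) (κ : ℝ) : Kernel (ℝ × ℝ) (ℝ × ℝ) :=
  rlKernel T ψ κ ∥ₖ rlKernel T ψ κ

/-- The two-variable Riemann-Liouville integral of order `κ` acting on functions. -/
def rlIntegral (T : ℝ) (ψ : ℝ → ℝ) (κ : ℝ) (u : ℝ × ℝ → ℝ) (x : ℝ × ℝ) : ℝ :=
  ∫ y, u y ∂(rlKernel₂ T ψ κ x)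

lemma rlKernel₂_apply (T : ℝ) (ψ : ℝ → ℝ) (κ : ℝ) (x : ℝ × ℝ) :
    rlKernel₂ T ψ κ x = (rlKernel T ψ κ x.1).prod (rlKernel T ψ κ x.2) :=
  Kernel.parallelComp_apply _ _ _

namespace IsClock

variable {T : ℝ} {ψ : ℝ → ℝ}

lemma isFiniteKernel_rlKernel₂ (H : IsClock T ψ) {κ : ℝ} (hκ : 0 ≤ κ) :
    IsFiniteKernel (rlKernel₂ T ψ κ) := by
  have := H.isFiniteKernel_rlKernel hκ
  unfold rlKernel₂
  infer_instance

lemma bddMeas_rlIntegral (H : IsClock T ψ) {κ : ℝ} (hκ : 0 ≤ κ) {u : ℝ × ℝ → ℝ}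
    (hu : BddMeas u) : BddMeas (rlIntegral T ψ κ u) :=
  have := H.isFiniteKernel_rlKernel₂ hκ
  hu.integral_kernel _

lemma rlIntegral_rlIntegral (H : IsClock T ψ) {a b : ℝ} (ha : 0 ≤ a) (hb : 0 ≤ b)
    {u : ℝ × ℝ → ℝ} (hu : BddMeas u) :
    rlIntegral T ψ a (rlIntegral T ψ b u) = rlIntegral T ψ (a + b) u := by
  have h : rlKernel₂ T ψ b ∘ₖ rlKernel₂ T ψ a = rlKernel₂ T ψ (a + b) := by
    rw [rlKernel₂, rlKernel₂, Kernel.parallelComp_comp_parallelComp, H.rlKernel_comp ha hb]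
    rfl
  have := H.isFiniteKernel_rlKernel₂ (add_nonneg ha hb)
  funext x
  unfold rlIntegral
  rw [← h, Kernel.integral_comp]
  rw [h]
  exact hu.integrable _

lemma rlIntegral_eq (H : IsClock T ψ) {κ : ℝ} (hκ : 0 ≤ κ) {u : ℝ × ℝ → ℝ} (hu : BddMeas u)
    (x : ℝ × ℝ) : rlIntegral T ψ κ u x =
      ∫ s₁, ∫ s₂, u (s₁, s₂) ∂(rlKernel T ψ κ x.2) ∂(rlKernel T ψ κ x.1) := by
  have := H.isFiniteKernel_rlKernel hκ
  rw [rlIntegral, rlKernel₂_apply, integral_prod _ (hu.integrable _)]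

lemma rlIntegral_eq_symm (H : IsClock T ψ) {κ : ℝ} (hκ : 0 ≤ κ) {u : ℝ × ℝ → ℝ}
    (hu : BddMeas u) (x : ℝ × ℝ) : rlIntegral T ψ κ u x =
      ∫ s₂, ∫ s₁, u (s₁, s₂) ∂(rlKernel T ψ κ x.1) ∂(rlKernel T ψ κ x.2) := by
  have := H.isFiniteKernel_rlKernel hκ
  rw [rlIntegral, rlKernel₂_apply, integral_prod_symm _ (hu.integrable _)]

lemma fracIntegral_eq_rlIntegral (H : IsClock T ψ) {κ : ℝ} (hκ : 0 ≤ κ) {u : ℝ × ℝ → ℝ}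
    (hu : BddMeas u) {x : ℝ × ℝ} (hx : x ∈ Ioo 0 T ×ˢ Ioo 0 T) :
    fracIntegral ψ κ u x = rlIntegral T ψ κ u x := by
  rcases hκ.eq_or_lt with rfl | hκ
  · rw [rlIntegral, rlKernel₂, rlKernel_zero, Kernel.id_parallelComp_id, Kernel.id_apply,
      integral_dirac, fracIntegral, if_pos rfl]
  · rw [H.rlIntegral_eq hκ.le hu, fracIntegral, if_neg hκ.ne', H.integral_rlKernel hκ hx.1,
      ← intervalIntegral.integral_const_mul]
    congr 1
    funext s₁
    rw [H.integral_rlKernel hκ hx.2, ← intervalIntegral.integral_const_mul,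
      ← intervalIntegral.integral_const_mul]
    congr 1
    funext s₂
    ring

end IsClock

lemma fracIntegral_congr {T : ℝ} {ψ : ℝ → ℝ} {κ : ℝ} {u v : ℝ × ℝ → ℝ}
    (h : EqOn u v (Ioo 0 T ×ˢ Ioo 0 T)) :
    EqOn (fracIntegral ψ κ u) (fracIntegral ψ κ v) (Ioo 0 T ×ˢ Ioo 0 T) := by
  intro x hx
  unfold fracIntegral
  split_ifs
  · exact h hx
  congr 1
  refine intervalIntegral.integral_congr_ae (Eventually.of_forall fun s₁ hs₁ => ?_)
  refine intervalIntegral.integral_congr_ae (Eventually.of_forall fun s₂ hs₂ => ?_)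
  rw [uIoc_of_le hx.1.1.le] at hs₁
  rw [uIoc_of_le hx.2.1.le] at hs₂
  rw [h (show (s₁, s₂) ∈ Ioo 0 T ×ˢ Ioo 0 T from
    ⟨⟨hs₁.1, hs₁.2.trans_lt hx.1.2⟩, ⟨hs₂.1, hs₂.2.trans_lt hx.2.2⟩⟩)]

lemma mixedDeriv_congr {T : ℝ} {ψ : ℝ → ℝ} {u v : ℝ × ℝ → ℝ}
    (h : EqOn u v (Ioo 0 T ×ˢ Ioo 0 T)) :
    EqOn (mixedDeriv ψ u) (mixedDeriv ψ v) (Ioo 0 T ×ˢ Ioo 0 T) := by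
  intro x hx
  unfold mixedDeriv
  congr 1
  apply EventuallyEq.deriv_eq
  filter_upwards [Ioo_mem_nhds hx.1.1 hx.1.2] with t₁ ht₁
  apply EventuallyEq.deriv_eq
  filter_upwards [Ioo_mem_nhds hx.2.1 hx.2.2] with t₂ ht₂
  exact h ⟨ht₁, ht₂⟩

namespace IsClock

variable {T : ℝ} {ψ : ℝ → ℝ}

/-- The fundamental theorem of calculus is applied in each variable. It needs continuous integrands,
and the inner integral of order `κ > 0` supplies this continuity even though `h` is only bounded and
measurable. -/
lemma mixedDeriv_rlIntegral_one (H : IsClock T ψ) {κ : ℝ} (hκ : 0 < κ) (hκ1 : κ ≤ 1)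
    {h : ℝ × ℝ → ℝ} (hh : BddMeas h) {x : ℝ × ℝ} (hx : x ∈ Ioo 0 T ×ˢ Ioo 0 T) :
    mixedDeriv ψ (rlIntegral T ψ 1 (rlIntegral T ψ κ h)) x = rlIntegral T ψ κ h x := by
  have := H.isFiniteKernel_rlKernel hκ.le
  have := H.isFiniteKernel_rlKernel (zero_le_one (α := ℝ))
  set g := rlIntegral T ψ κ h with hg
  have hgb : BddMeas g := H.bddMeas_rlIntegral hκ.le hh
  have hh₁ : BddMeas fun y : ℝ × ℝ => ∫ σ, h (σ, y.2) ∂(rlKernel T ψ κ y.1) :=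
    BddMeas.integral_kernel_prod (f := fun z : (ℝ × ℝ) × ℝ => h (z.2, z.1.2))
      (hh.comp (by fun_prop)) ((rlKernel T ψ κ).comap Prod.fst measurable_fst)
  have hh₂ : BddMeas fun y : ℝ × ℝ => ∫ σ, h (y.1, σ) ∂(rlKernel T ψ κ y.2) :=
    BddMeas.integral_kernel_prod (f := fun z : (ℝ × ℝ) × ℝ => h (z.1.1, z.2))
      (hh.comp (by fun_prop)) ((rlKernel T ψ κ).comap Prod.snd measurable_snd)
  have hg₁ : ∀ t₁, BddMeas fun s₂ => ∫ s₁, g (s₁, s₂) ∂(rlKernel T ψ 1 t₁) := fun t₁ =>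
    BddMeas.integral_kernel_prod (f := fun z : ℝ × ℝ => g (z.2, z.1))
      (hgb.comp (by fun_prop)) (Kernel.const ℝ (rlKernel T ψ 1 t₁))
  have hc₁ : ∀ t₁, ContinuousOn (fun s₂ => ∫ s₁, g (s₁, s₂) ∂(rlKernel T ψ 1 t₁)) (Ioo 0 T) := by
    intro t₁
    have hb : BddMeas fun σ₂ =>
        ∫ s₁, (∫ σ₁, h (σ₁, σ₂) ∂(rlKernel T ψ κ s₁)) ∂(rlKernel T ψ 1 t₁) :=
      BddMeas.integral_kernel_prod
        (f := fun z : ℝ × ℝ => ∫ σ₁, h (σ₁, z.1) ∂(rlKernel T ψ κ z.2))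
        (hh₁.comp (measurable_snd.prodMk measurable_fst)) (Kernel.const ℝ (rlKernel T ψ 1 t₁))
    -- By Fubini, the partially integrated `g` is itself a one-variable integral of order `κ` of a
    -- bounded function.
    refine (H.continuousOn_integral_rlKernel hκ hκ1 hb).congr fun s₂ _ => ?_
    simp only [hg, H.rlIntegral_eq_symm hκ.le hh]
    exact integral_integral_swap (hh₁.integrable _)
  have hc₂ : ContinuousOn (fun s₁ => g (s₁, x.2)) (Ioo 0 T) := by
    have hb : BddMeas fun σ₁ => ∫ σ₂, h (σ₁, σ₂) ∂(rlKernel T ψ κ x.2) :=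
      hh₂.comp (g := fun σ₁ => (σ₁, x.2)) (by fun_prop)
    refine (H.continuousOn_integral_rlKernel hκ hκ1 hb).congr fun s₁ _ => ?_
    rw [hg, H.rlIntegral_eq hκ.le hh]
  -- Valid for every real `t₁`, so it can be rewritten under the outer `deriv`.
  have hd₂ : ∀ t₁, deriv (fun t₂ => rlIntegral T ψ 1 g (t₁, t₂)) x.2 =
      deriv ψ x.2 * ∫ s₁, g (s₁, x.2) ∂(rlKernel T ψ 1 t₁) := by
    intro t₁
    simp_rw [H.rlIntegral_eq_symm zero_le_one hgb]
    exact (H.hasDerivAt_integral_rlKernel_one (hg₁ t₁) (hc₁ t₁) hx.2).deriv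
  have hd₁ := H.hasDerivAt_integral_rlKernel_one
    (hgb.comp (g := fun s₁ => (s₁, x.2)) (by fun_prop)) hc₂ hx.1
  unfold mixedDeriv
  simp_rw [hd₂]
  rw [(hd₁.const_mul (deriv ψ x.2)).deriv]
  have h1 := H.deriv_pos hx.1
  have h2 := H.deriv_pos hx.2
  field_simp

end IsClock

/-! ### Test functions and the Hilfer derivative -/

namespace IsTest

variable {T : ℝ} {φ : ℝ × ℝ → ℝ}

lemma eq_zero (hφ : IsTest T φ) {x : ℝ × ℝ} (hx : x ∉ Ioo 0 T ×ˢ Ioo 0 T) : φ x = 0 :=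
  image_eq_zero_of_notMem_tsupport fun h => hx (hφ.2.2 h)

lemma bddMeas (hφ : IsTest T φ) : BddMeas φ := by
  refine ⟨hφ.1.continuous.measurable, ?_⟩
  obtain ⟨C, hC⟩ := hφ.2.1.exists_bound_of_continuous hφ.1.continuous
  exact ⟨C, hC⟩

lemma hasDerivAt_fst (hφ : IsTest T φ) (x : ℝ × ℝ) :
    HasDerivAt (fun t => φ (t, x.2)) (fderiv ℝ φ x (1, 0)) x.1 := by
  have h := (hφ.1.differentiable (by simp) x).hasFDerivAt
  exact h.comp_hasDerivAt (f := fun t => (t, x.2)) x.1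
    ((hasDerivAt_id _).prodMk (hasDerivAt_const _ _))

lemma hasDerivAt_snd (hφ : IsTest T φ) (x : ℝ × ℝ) :
    HasDerivAt (fun t => φ (x.1, t)) (fderiv ℝ φ x (0, 1)) x.2 := by
  have h := (hφ.1.differentiable (by simp) x).hasFDerivAt
  exact h.comp_hasDerivAt (f := fun t => (x.1, t)) x.2
    ((hasDerivAt_const _ _).prodMk (hasDerivAt_id _))

lemma fderiv_apply (hφ : IsTest T φ) (v : ℝ × ℝ) : IsTest T fun x => fderiv ℝ φ x v :=
  ⟨(hφ.1.fderiv_right (m := ∞) (by simp)).clm_apply contDiff_const,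
    hφ.2.1.fderiv_apply ℝ v,
    (tsupport_fderiv_apply_subset ℝ v).trans hφ.2.2⟩

lemma mixedDeriv_eq (hφ : IsTest T φ) (ψ : ℝ → ℝ) (x : ℝ × ℝ) :
    mixedDeriv ψ φ x = 1 / (deriv ψ x.1 * deriv ψ x.2) *
      fderiv ℝ (fun y => fderiv ℝ φ y (0, 1)) x (1, 0) := by
  unfold mixedDeriv
  have : (fun t₁ => deriv (fun t₂ => φ (t₁, t₂)) x.2) =
      fun t₁ => fderiv ℝ φ (t₁, x.2) (0, 1) := by
    funext t₁
    exact (hφ.hasDerivAt_snd (t₁, x.2)).deriv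
  rw [this, ((hφ.fderiv_apply (0, 1)).hasDerivAt_fst x).deriv]

end IsTest

namespace IsClock

variable {T : ℝ} {ψ : ℝ → ℝ} {φ : ℝ × ℝ → ℝ}

lemma bddMeas_mixedDeriv (H : IsClock T ψ) (hφ : IsTest T φ) : BddMeas (mixedDeriv ψ φ) := by
  have hφ₁₂ := (hφ.fderiv_apply (0, 1)).fderiv_apply (1, 0)
  obtain ⟨hm, M, hM⟩ := hφ₁₂.bddMeas
  have hd := measurable_deriv ψ
  have e : mixedDeriv ψ φ = _ := funext (hφ.mixedDeriv_eq ψ)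
  rw [e]
  refine ⟨(measurable_const.div ((hd.comp measurable_fst).mul (hd.comp measurable_snd))).mul hm, ?_⟩
  obtain ⟨c, B, hc, -, hcB⟩ := H.exists_bounds
  have hM0 : 0 ≤ M := (abs_nonneg _).trans (hM 0)
  refine ⟨1 / (c * c) * M, fun x => ?_⟩
  by_cases hx : x ∈ Ioo 0 T ×ˢ Ioo 0 T
  · have h1 := (hcB _ hx.1).1
    have h2 := (hcB _ hx.2).1
    have h3 := H.deriv_pos hx.1
    have h4 := H.deriv_pos hx.2
    rw [abs_mul, abs_of_pos (by positivity)]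
    gcongr
    exact hM x
  -- Outside the open square nothing is known about `deriv ψ`, but the mixed partial of `φ` vanishes
  -- there.
  · have h0 := hφ₁₂.eq_zero hx
    simp only [h0, mul_zero, abs_zero]
    positivity

lemma integral_rlKernel_one (H : IsClock T ψ) {x : ℝ} (hx : x ∈ Ioo 0 T) (f : ℝ → ℝ) :
    ∫ s, f s ∂(rlKernel T ψ 1 x) = ∫ s in (0 : ℝ)..x, deriv ψ s * f s := by
  rw [H.integral_rlKernel one_pos hx]
  simp

/-- A test function is the Riemann-Liouville integral of order one of its mixed derivative. -/
lemma rlIntegral_one_mixedDeriv (H : IsClock T ψ) (hφ : IsTest T φ) :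
    EqOn φ (rlIntegral T ψ 1 (mixedDeriv ψ φ)) (Ioo 0 T ×ˢ Ioo 0 T) := by
  intro x hx
  have hφ₂ := hφ.fderiv_apply (0, 1)
  have hφ₁₂ := hφ₂.fderiv_apply (1, 0)
  rw [H.rlIntegral_eq_symm zero_le_one (H.bddMeas_mixedDeriv hφ), H.integral_rlKernel_one hx.2]
  have inner : ∀ s₂ ∈ Ioo 0 T,
      ∫ s₁, mixedDeriv ψ φ (s₁, s₂) ∂(rlKernel T ψ 1 x.1) =
        1 / deriv ψ s₂ * fderiv ℝ φ (x.1, s₂) (0, 1) := by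
    intro s₂ hs₂
    rw [H.integral_rlKernel_one hx.1]
    have h1 : ∫ s₁ in (0 : ℝ)..x.1, deriv ψ s₁ * mixedDeriv ψ φ (s₁, s₂) =
        ∫ s₁ in (0 : ℝ)..x.1, 1 / deriv ψ s₂ *
          fderiv ℝ (fun y => fderiv ℝ φ y (0, 1)) (s₁, s₂) (1, 0) := by
      refine intervalIntegral.integral_congr_ae (Eventually.of_forall fun s₁ hs₁ => ?_)
      rw [uIoc_of_le hx.1.1.le] at hs₁
      have h3 := H.deriv_pos ⟨hs₁.1, hs₁.2.trans_lt hx.1.2⟩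
      have h4 := H.deriv_pos hs₂
      rw [hφ.mixedDeriv_eq]
      field_simp
    rw [h1, intervalIntegral.integral_const_mul]
    congr 1
    rw [intervalIntegral.integral_eq_sub_of_hasDerivAt
      (f := fun s₁ => fderiv ℝ φ (s₁, s₂) (0, 1)) (fun s₁ _ => hφ₂.hasDerivAt_fst (s₁, s₂))]
    · rw [hφ₂.eq_zero (x := (0, s₂)) fun h => lt_irrefl _ h.1.1, sub_zero]
    · exact (hφ₁₂.1.continuous.comp (by fun_prop : Continuous fun s₁ => (s₁, s₂))).intervalIntegrable
        _ _
  have h2 : ∫ s₂ in (0 : ℝ)..x.2, deriv ψ s₂ *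
        ∫ s₁, mixedDeriv ψ φ (s₁, s₂) ∂(rlKernel T ψ 1 x.1) =
      ∫ s₂ in (0 : ℝ)..x.2, fderiv ℝ φ (x.1, s₂) (0, 1) := by
    refine intervalIntegral.integral_congr_ae (Eventually.of_forall fun s₂ hs₂ => ?_)
    rw [uIoc_of_le hx.2.1.le] at hs₂
    have h3 : s₂ ∈ Ioo 0 T := ⟨hs₂.1, hs₂.2.trans_lt hx.2.2⟩
    have h4 := H.deriv_pos h3
    rw [inner _ h3]
    field_simp
  rw [h2, intervalIntegral.integral_eq_sub_of_hasDerivAt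
    (f := fun s₂ => φ (x.1, s₂)) (fun s₂ _ => hφ.hasDerivAt_snd (x.1, s₂))]
  · rw [hφ.eq_zero (x := (x.1, 0)) fun h => lt_irrefl _ h.2.1, sub_zero]
  · exact (hφ₂.1.continuous.comp (by fun_prop : Continuous fun s₂ => (x.1, s₂))).intervalIntegrable
      _ _

/-- On test functions the Hilfer derivative of order `α` is the Riemann-Liouville integral of order
`1 - α` of the mixed derivative, whatever the type `β`. -/
lemma hilferDeriv_eq (H : IsClock T ψ) (hφ : IsTest T φ) {α β : ℝ} (hα₀ : 0 < α) (hα₁ : α < 1)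
    (hβ₀ : 0 ≤ β) (hβ₁ : β ≤ 1) :
    EqOn (hilferDeriv ψ α β φ) (rlIntegral T ψ (1 - α) (mixedDeriv ψ φ))
      (Ioo 0 T ×ˢ Ioo 0 T) := by
  have hb := H.bddMeas_mixedDeriv hφ
  have hκ₁ : 0 ≤ β * (1 - α) := mul_nonneg hβ₀ (by linarith)
  have hκ₂ : 0 ≤ (1 - β) * (1 - α) := mul_nonneg (by linarith) (by linarith)
  have hκ₂' : (1 - β) * (1 - α) ≤ 1 := by nlinarith
  have hinner : EqOn (mixedDeriv ψ (fracIntegral ψ ((1 - β) * (1 - α)) φ))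
      (rlIntegral T ψ ((1 - β) * (1 - α)) (mixedDeriv ψ φ)) (Ioo 0 T ×ˢ Ioo 0 T) := by
    -- Order zero (`β = 1`) is separate: both integrals are the identity, and there is no smoothing
    -- to invoke.
    rcases hκ₂.eq_or_lt with h0 | h0
    · intro x hx
      rw [← h0, ← H.fracIntegral_eq_rlIntegral le_rfl hb hx, fracIntegral, if_pos rfl]
      congr 1
      funext y
      rw [fracIntegral, if_pos rfl]
    -- Writing `φ` as an integral of order one of its mixed derivative, the semigroup law lets the
    -- two integrals commute; the mixed derivative then undoes the outer one.
    · have h1 : EqOn (fracIntegral ψ ((1 - β) * (1 - α)) φ)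
          (rlIntegral T ψ 1 (rlIntegral T ψ ((1 - β) * (1 - α)) (mixedDeriv ψ φ)))
          (Ioo 0 T ×ˢ Ioo 0 T) := by
        refine (fracIntegral_congr (H.rlIntegral_one_mixedDeriv hφ)).trans fun x hx => ?_
        rw [H.fracIntegral_eq_rlIntegral hκ₂ (H.bddMeas_rlIntegral zero_le_one hb) hx,
          H.rlIntegral_rlIntegral hκ₂ zero_le_one hb, H.rlIntegral_rlIntegral zero_le_one hκ₂ hb,
          add_comm]
      exact (mixedDeriv_congr h1).trans fun x hx => H.mixedDeriv_rlIntegral_one h0 hκ₂' hb hx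
  refine (fracIntegral_congr hinner).trans fun x hx => ?_
  rw [H.fracIntegral_eq_rlIntegral hκ₁ (H.bddMeas_rlIntegral hκ₂ hb) hx,
    H.rlIntegral_rlIntegral hκ₁ hκ₂ hb]
  congr 1
  ring

/-! ### The bound from `L^p` to `L^∞` -/

/-- A bound for the densities of order `α > 1 / p` in `L^{p'}`, uniform in the base point. -/
lemma exists_lintegral_rlDensity_rpow_le (H : IsClock T ψ) {α p' : ℝ} (hα : 0 < α) (hp' : 1 < p')
    (h : 0 < (α - 1) * p' + 1) :
    ∃ M : ℝ≥0∞, M ≠ ⊤ ∧ ∀ x, ∫⁻ s, ENNReal.ofReal (rlDensity T ψ α x s) ^ p' ≤ M := by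
  obtain ⟨c, B, hc, hB, hcB⟩ := H.exists_bounds
  -- With this `κ`, the `p'`-th power of the density of order `α` has the singularity of the density
  -- of order `κ`; the surplus factor `(ψ')^(p' - 1)` is at most `B^(p' - 1)`.
  set κ := (α - 1) * p' + 1 with hκ
  have := H.isFiniteKernel_rlKernel h.le
  have hGα := Real.Gamma_pos_of_pos hα
  have hGκ := Real.Gamma_pos_of_pos h
  set A := B ^ (p' - 1) * Real.Gamma κ / Real.Gamma α ^ p' with hA
  refine ⟨ENNReal.ofReal A * (rlKernel T ψ κ).bound,
    ENNReal.mul_ne_top ENNReal.ofReal_ne_top (Kernel.bound_ne_top _), fun x => ?_⟩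
  have hpt : ∀ s, ENNReal.ofReal (rlDensity T ψ α x s) ^ p' ≤
      ENNReal.ofReal A * ENNReal.ofReal (rlDensity T ψ κ x s) := by
    intro s
    rw [ENNReal.ofReal_rpow_of_nonneg (H.rlDensity_nonneg hα x s) (by linarith),
      ← ENNReal.ofReal_mul (by positivity)]
    apply ENNReal.ofReal_le_ofReal
    by_cases hs : 0 < s ∧ s < x ∧ x < T
    · have h1 := sub_pos.2 (H.lt hs.1.le hs.2.1 hs.2.2)
      have hsT : s ∈ Ioo 0 T := ⟨hs.1, hs.2.1.trans hs.2.2⟩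
      have h2 := H.deriv_pos hsT
      rw [rlDensity_of_mem ⟨hs.1, hs.2.1⟩ hs.2.2, rlDensity_of_mem ⟨hs.1, hs.2.1⟩ hs.2.2,
        Real.div_rpow (by positivity) hGα.le, Real.mul_rpow h2.le (by positivity),
        ← Real.rpow_mul h1.le, hκ, add_sub_cancel_right]
      calc deriv ψ s ^ p' * (ψ x - ψ s) ^ ((α - 1) * p') / Real.Gamma α ^ p'
          = deriv ψ s ^ (p' - 1) * (deriv ψ s * (ψ x - ψ s) ^ ((α - 1) * p')) /
            Real.Gamma α ^ p' := by
            rw [← mul_assoc, ← Real.rpow_add_one h2.ne', sub_add_cancel]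
        _ ≤ B ^ (p' - 1) * (deriv ψ s * (ψ x - ψ s) ^ ((α - 1) * p')) / Real.Gamma α ^ p' := by
            have h3 := (hcB s hsT).2
            gcongr
        _ = _ := by
            rw [hA, ← hκ]
            field_simp
    · rw [rlDensity_of_notMem hs, rlDensity_of_notMem hs, Real.zero_rpow (by linarith), mul_zero]
  refine (lintegral_mono hpt).trans ?_
  rw [lintegral_const_mul' _ _ ENNReal.ofReal_ne_top]
  gcongr
  have hb := Kernel.measure_le_bound (rlKernel T ψ κ) x univ
  rwa [H.rlKernel_apply h.ne', withDensity_apply _ MeasurableSet.univ, setLIntegral_univ] at hb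

/-- For `α > 1 / p` the Riemann-Liouville integral of order `α` maps `L^p` to `L^∞`. -/
lemma exists_enorm_rlIntegral_le (H : IsClock T ψ) {α p : ℝ} (hp : 1 < p) (hα : 1 / p < α) :
    ∃ C : ℝ≥0∞, C ≠ ⊤ ∧ ∀ u : ℝ × ℝ → ℝ, Measurable u → ∀ x,
      ‖rlIntegral T ψ α u x‖ₑ ≤ C * eLpNorm u (ENNReal.ofReal p) (vol T) := by
  have hp0 : 0 < p := by linarith
  have hα0 : 0 < α := (by positivity : 0 < 1 / p).trans hα
  have hpq := Real.HolderConjugate.conjExponent hp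
  set p' := p.conjExponent with hp'
  have hq1 : 1 < p' := hpq.symm.lt
  -- The quantity equals `p' (α - 1/p)`: this is where `α > 1/p` enters.
  have hpos : 0 < (α - 1) * p' + 1 := by
    have h1 : 1 / p' = 1 - 1 / p := by
      have := hpq.inv_add_inv_eq_one
      rw [one_div, one_div]
      linarith
    have h2 : 0 < α - 1 + 1 / p' := by linarith
    have h3 : (α - 1) * p' + 1 = (α - 1 + 1 / p') * p' := by
      field_simp
    rw [h3]
    positivity
  obtain ⟨M, hM, hMle⟩ := H.exists_lintegral_rlDensity_rpow_le hα0 hq1 hpos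
  refine ⟨(M * M) ^ (1 / p'), ENNReal.rpow_ne_top_of_nonneg (by positivity)
    (ENNReal.mul_ne_top hM hM), fun u hu x => ?_⟩
  have hm : ∀ y, Measurable fun s => ENNReal.ofReal (rlDensity T ψ α y s) := fun y =>
    (H.measurable_ofReal_rlDensity α).comp measurable_prodMk_left
  set ρ : ℝ × ℝ → ℝ≥0∞ := fun s => ENNReal.ofReal (rlDensity T ψ α x.1 s.1) *
    ENNReal.ofReal (rlDensity T ψ α x.2 s.2) with hρ
  have hρm : Measurable ρ := ((hm x.1).comp measurable_fst).mul ((hm x.2).comp measurable_snd)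
  have hρ0 : ∀ s, s ∉ square T → ρ s = 0 := by
    intro s hs
    by_cases h1 : s.1 ∈ Icc 0 T
    · have h2 : s.2 ∉ Icc 0 T := fun h2 => hs ⟨h1, h2⟩
      simp only [hρ]
      rw [rlDensity_of_notMem (s := s.2) fun h => h2 ⟨h.1.le, (h.2.1.trans h.2.2).le⟩]
      simp
    · simp only [hρ]
      rw [rlDensity_of_notMem (s := s.1) fun h => h1 ⟨h.1.le, (h.2.1.trans h.2.2).le⟩]
      simp
  have hsq : MeasurableSet (square T) := measurableSet_Icc.prod measurableSet_Icc
  have hkernel : rlKernel₂ T ψ α x = volume.withDensity ρ := by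
    rw [rlKernel₂_apply, H.rlKernel_apply hα0.ne', H.rlKernel_apply hα0.ne',
      prod_withDensity (hm x.1) (hm x.2)]
    rfl
  have hp_ne : ENNReal.ofReal p ≠ 0 := (ENNReal.ofReal_pos.2 hp0).ne'
  calc ‖rlIntegral T ψ α u x‖ₑ
      ≤ ∫⁻ s, ‖u s‖ₑ ∂(volume.withDensity ρ) := by
        rw [← hkernel]
        exact enorm_integral_le_lintegral_enorm _
    _ = ∫⁻ s, (ρ * fun s => ‖u s‖ₑ) s ∂(vol T) := by
        rw [lintegral_withDensity_eq_lintegral_mul _ hρm hu.enorm, vol, ← lintegral_indicator hsq]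
        refine lintegral_congr fun s => ?_
        by_cases hs : s ∈ square T
        · rw [indicator_of_mem hs]
        · rw [indicator_of_notMem hs, Pi.mul_apply, hρ0 s hs, zero_mul]
    _ ≤ (∫⁻ s, ρ s ^ p' ∂(vol T)) ^ (1 / p') * (∫⁻ s, ‖u s‖ₑ ^ p ∂(vol T)) ^ (1 / p) :=
        ENNReal.lintegral_mul_le_Lp_mul_Lq _ hpq.symm hρm.aemeasurable hu.enorm.aemeasurable
    _ ≤ (M * M) ^ (1 / p') * (∫⁻ s, ‖u s‖ₑ ^ p ∂(vol T)) ^ (1 / p) := by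
        gcongr
        calc ∫⁻ s, ρ s ^ p' ∂(vol T) ≤ ∫⁻ s, ρ s ^ p' :=
              lintegral_mono' Measure.restrict_le_self le_rfl
          _ = ∫⁻ s : ℝ × ℝ, ENNReal.ofReal (rlDensity T ψ α x.1 s.1) ^ p' *
              ENNReal.ofReal (rlDensity T ψ α x.2 s.2) ^ p' := by
              simp_rw [hρ, ENNReal.mul_rpow_of_nonneg _ _ (by linarith : 0 ≤ p')]
          _ = (∫⁻ s, ENNReal.ofReal (rlDensity T ψ α x.1 s) ^ p') *
              ∫⁻ s, ENNReal.ofReal (rlDensity T ψ α x.2 s) ^ p' :=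
              lintegral_prod_mul ((hm x.1).pow_const _).aemeasurable
                ((hm x.2).pow_const _).aemeasurable
          _ ≤ M * M := mul_le_mul' (hMle _) (hMle _)
    _ = _ := by
        rw [eLpNorm_eq_lintegral_rpow_enorm_toReal hp_ne ENNReal.ofReal_ne_top,
          ENNReal.toReal_ofReal hp0.le]

end IsClock

/-! ### Luxemburg norms and the embedding of the completion into `L^∞` -/

instance (T : ℝ) : IsFiniteMeasure (vol T) := by
  refine ⟨?_⟩
  rw [vol, Measure.restrict_apply_univ]
  exact (isCompact_Icc.prod isCompact_Icc).measure_lt_top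

lemma ae_mem_interior_square (T : ℝ) : ∀ᵐ x ∂(vol T), x ∈ Ioo 0 T ×ˢ Ioo 0 T := by
  have h : (Ioo 0 T ×ˢ Ioo 0 T : Set (ℝ × ℝ)) =ᵐ[volume] square T :=
    Measure.set_prod_ae_eq Ioo_ae_eq_Icc Ioo_ae_eq_Icc
  rw [vol, ← Measure.restrict_congr_set h]
  exact ae_restrict_mem (measurableSet_Ioo.prod measurableSet_Ioo)

section Luxemburg

variable {T p q : ℝ} {μ : ℝ × ℝ → ℝ}

lemma lintegral_rpow_le_modular (hp : 0 < p) (hμ₀ : ∀ᵐ x ∂(vol T), 0 ≤ μ x) (w : ℝ × ℝ → ℝ) :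
    ∫⁻ x, ‖w x‖ₑ ^ p ∂(vol T) ≤ modular T p q μ w := by
  refine lintegral_mono_ae (hμ₀.mono fun x hx => ?_)
  rw [← ofReal_norm, Real.norm_eq_abs,
    ENNReal.ofReal_rpow_of_nonneg (abs_nonneg _) hp.le]
  apply ENNReal.ofReal_le_ofReal
  have : 0 ≤ μ x * |w x| ^ q := by positivity
  linarith

/-- The Luxemburg norm dominates the `L^p` norm. -/
lemma eLpNorm_le_luxNorm (hp : 0 < p) (hμ₀ : ∀ᵐ x ∂(vol T), 0 ≤ μ x) (w : ℝ × ℝ → ℝ) :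
    eLpNorm w (ENNReal.ofReal p) (vol T) ≤ luxNorm T p q μ w := by
  refine le_sInf ?_
  rintro _ ⟨τ, hτ, hmod, rfl⟩
  have h1 : eLpNorm (fun x => w x / τ) (ENNReal.ofReal p) (vol T) ≤ 1 := by
    rw [eLpNorm_eq_lintegral_rpow_enorm_toReal (ENNReal.ofReal_pos.2 hp).ne'
      ENNReal.ofReal_ne_top, ENNReal.toReal_ofReal hp.le]
    exact ENNReal.rpow_le_one ((lintegral_rpow_le_modular hp hμ₀ _).trans hmod) (by positivity)
  have h2 : w = τ • fun x => w x / τ := by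
    funext x
    simp only [Pi.smul_apply, smul_eq_mul]
    field_simp
  rw [h2, eLpNorm_const_smul, Real.enorm_eq_ofReal hτ.le]
  exact mul_le_of_le_one_right' h1

lemma MemLH.memLp (hp : 0 < p) (hμ₀ : ∀ᵐ x ∂(vol T), 0 ≤ μ x) {w : ℝ × ℝ → ℝ}
    (hw : MemLH T p q μ w) : MemLp w (ENNReal.ofReal p) (vol T) := by
  refine ⟨hw.1, ?_⟩
  rw [eLpNorm_lt_top_iff_lintegral_rpow_enorm_lt_top (ENNReal.ofReal_pos.2 hp).ne'
    ENNReal.ofReal_ne_top, ENNReal.toReal_ofReal hp.le]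
  exact (lintegral_rpow_le_modular hp hμ₀ w).trans_lt hw.2

end Luxemburg

/-- The embedding of the fractional space into `L^∞`. -/
lemma IsClock.exists_ae_enorm_le {T α β p q : ℝ} {ψ : ℝ → ℝ} {μ : ℝ × ℝ → ℝ} (H : IsClock T ψ)
    (hp : 1 < p) (hα : 1 / p < α) (hα₁ : α < 1) (hβ₀ : 0 ≤ β) (hβ₁ : β ≤ 1)
    (hμ₀ : ∀ᵐ x ∂(vol T), 0 ≤ μ x) :
    ∃ C : ℝ≥0∞, C ≠ ⊤ ∧ ∀ u v, HasHilferDeriv T α β p q ψ μ u v →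
      ∀ᵐ x ∂(vol T), ‖u x‖ₑ ≤ C * eLpNorm v (ENNReal.ofReal p) (vol T) := by
  have hp0 : 0 < p := by linarith
  have hα0 : 0 < α := (by positivity : 0 < 1 / p).trans hα
  obtain ⟨C, hC, hCle⟩ := H.exists_enorm_rlIntegral_le hp hα
  refine ⟨C, hC, fun u v ⟨hu, hv, φ, hφ, hlim⟩ => ?_⟩
  have hp1 : 1 ≤ ENNReal.ofReal p := ENNReal.one_le_ofReal.2 hp.le
  have hD : ∀ n, hilferDeriv ψ α β (φ n) =ᵐ[vol T]
      rlIntegral T ψ (1 - α) (mixedDeriv ψ (φ n)) := fun n =>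
    (ae_mem_interior_square T).mono fun x hx => H.hilferDeriv_eq (hφ n) hα0 hα₁ hβ₀ hβ₁ hx
  have hDm : ∀ n, BddMeas (rlIntegral T ψ (1 - α) (mixedDeriv ψ (φ n))) := fun n =>
    H.bddMeas_rlIntegral (by linarith) (H.bddMeas_mixedDeriv (hφ n))
  -- On test functions `φ` is the integral of order `α` of its Hilfer derivative, since `α + (1 - α)
  -- = 1`.
  have htest : ∀ n, ∀ x ∈ Ioo 0 T ×ˢ Ioo 0 T,
      ‖φ n x‖ₑ ≤ C * eLpNorm (hilferDeriv ψ α β (φ n)) (ENNReal.ofReal p) (vol T) := by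
    intro n x hx
    have h1 : rlIntegral T ψ α (rlIntegral T ψ (1 - α) (mixedDeriv ψ (φ n))) x = φ n x := by
      rw [H.rlIntegral_rlIntegral hα0.le (by linarith) (H.bddMeas_mixedDeriv (hφ n)),
        add_sub_cancel, ← H.rlIntegral_one_mixedDeriv (hφ n) hx]
    rw [eLpNorm_congr_ae (hD n), ← h1]
    exact hCle _ (hDm n).1 x
  have hu0 : Tendsto (fun n => eLpNorm (φ n - u) (ENNReal.ofReal p) (vol T)) atTop (𝓝 0) :=
    tendsto_of_tendsto_of_tendsto_of_le_of_le tendsto_const_nhds hlim (fun _ => zero_le)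
      fun n => (eLpNorm_le_luxNorm hp0 hμ₀ _).trans le_self_add
  have hv0 : Tendsto (fun n => eLpNorm (hilferDeriv ψ α β (φ n) - v) (ENNReal.ofReal p) (vol T))
      atTop (𝓝 0) :=
    tendsto_of_tendsto_of_tendsto_of_le_of_le tendsto_const_nhds hlim (fun _ => zero_le)
      fun n => (eLpNorm_le_luxNorm hp0 hμ₀ _).trans le_add_self
  -- Convergence in `L^p` gives an a.e. convergent subsequence, along which the pointwise bounds
  -- pass to the limit.
  obtain ⟨ns, hns, hae⟩ := (tendstoInMeasure_of_tendsto_eLpNorm (ENNReal.ofReal_pos.2 hp0).ne'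
    (fun n => (hφ n).1.continuous.aestronglyMeasurable) hu.1 hu0).exists_seq_tendsto_ae
  filter_upwards [hae, ae_mem_interior_square T] with x hx hxI
  have hle : ∀ n, ‖φ (ns n) x‖ₑ ≤
      C * (eLpNorm (hilferDeriv ψ α β (φ (ns n)) - v) (ENNReal.ofReal p) (vol T) +
        eLpNorm v (ENNReal.ofReal p) (vol T)) := by
    intro n
    refine (htest (ns n) x hxI).trans (mul_le_mul_right ?_ _)
    have hm : AEStronglyMeasurable (hilferDeriv ψ α β (φ (ns n))) (vol T) :=
      (hDm (ns n)).1.aestronglyMeasurable.congr (hD (ns n)).symm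
    have := eLpNorm_add_le (hm.sub hv.1) hv.1 hp1
    rwa [sub_add_cancel] at this
  have hlim2 : Tendsto (fun n =>
      C * (eLpNorm (hilferDeriv ψ α β (φ (ns n)) - v) (ENNReal.ofReal p) (vol T) +
        eLpNorm v (ENNReal.ofReal p) (vol T))) atTop
      (𝓝 (C * (0 + eLpNorm v (ENNReal.ofReal p) (vol T)))) :=
    ENNReal.Tendsto.const_mul ((hv0.comp hns.tendsto_atTop).add_const _) (Or.inr hC)
  rw [zero_add] at hlim2
  exact le_of_tendsto_of_tendsto' hx.enorm hlim2 hle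

/-- The embedding of the fractional space into `L^∞`, in terms of `∫ |v|^p`. -/
lemma IsClock.exists_ae_abs_le {T α β p q : ℝ} {ψ : ℝ → ℝ} {μ : ℝ × ℝ → ℝ} (H : IsClock T ψ)
    (hp : 1 < p) (hα : 1 / p < α) (hα₁ : α < 1) (hβ₀ : 0 ≤ β) (hβ₁ : β ≤ 1)
    (hμ₀ : ∀ᵐ x ∂(vol T), 0 ≤ μ x) :
    ∃ C : ℝ, 0 ≤ C ∧ ∀ u v, HasHilferDeriv T α β p q ψ μ u v →
      ∀ᵐ x ∂(vol T), |u x| ≤ C * normPow T p v ^ (1 / p) := by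
  have hp0 : 0 < p := by linarith
  obtain ⟨C, hC, hCle⟩ := H.exists_ae_enorm_le (q := q) hp hα hα₁ hβ₀ hβ₁ hμ₀
  refine ⟨C.toReal, ENNReal.toReal_nonneg, fun u v huv => ?_⟩
  have hv := huv.2.1.memLp hp0 hμ₀
  filter_upwards [hCle u v huv] with x hx
  have hN := hv.eLpNorm_eq_integral_rpow_norm (ENNReal.ofReal_pos.2 hp0).ne' ENNReal.ofReal_ne_top
  rw [ENNReal.toReal_ofReal hp0.le] at hN
  have hP : 0 ≤ normPow T p v := integral_nonneg fun _ => by positivity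
  have h := ENNReal.toReal_mono (ENNReal.mul_ne_top hC hv.eLpNorm_ne_top) hx
  rw [toReal_enorm, Real.norm_eq_abs, ENNReal.toReal_mul, hN, ENNReal.toReal_ofReal] at h
  · simpa only [normPow, one_div, Real.norm_eq_abs] using h
  · simp only [Real.norm_eq_abs]
    exact Real.rpow_nonneg hP _

/-! ### Elimination between the Nehari identities and conclusion -/

lemma normPow_le {T s K : ℝ} (hs : 0 ≤ s) {u : ℝ × ℝ → ℝ} (hu : ∀ᵐ x ∂(vol T), |u x| ≤ K) :
    normPow T s u ≤ K ^ s * (vol T).real univ := by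
  refine (Real.le_norm_self _).trans (norm_integral_le_of_norm_le_const (hu.mono fun x hx => ?_))
  rw [Real.norm_eq_abs, abs_of_nonneg (by positivity)]
  exact Real.rpow_le_rpow (abs_nonneg _) hx hs

lemma exists_weightedNormPow_le {T : ℝ} {w : ℝ × ℝ → ℝ} (hw : MemLp w ⊤ (vol T)) :
    ∃ M : ℝ, 0 ≤ M ∧ ∀ s K : ℝ, 0 ≤ s → ∀ u : ℝ × ℝ → ℝ, (∀ᵐ x ∂(vol T), |u x| ≤ K) →
      weightedNormPow T s w u ≤ M * K ^ s := by
  set W := (eLpNorm w ⊤ (vol T)).toReal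
  have hW : ∀ᵐ x ∂(vol T), |w x| ≤ W := by
    filter_upwards [ae_le_eLpNormEssSup (f := w) (μ := vol T)] with x hx
    rw [← eLpNorm_exponent_top] at hx
    have := ENNReal.toReal_mono hw.eLpNorm_ne_top hx
    rwa [toReal_enorm] at this
  refine ⟨W * (vol T).real univ, by positivity, fun s K hs u hu => ?_⟩
  have h : weightedNormPow T s w u ≤ W * K ^ s * (vol T).real univ := by
    refine (Real.le_norm_self _).trans (norm_integral_le_of_norm_le_const ?_)
    filter_upwards [hu, hW] with x hx hwx
    rw [norm_mul, Real.norm_eq_abs, Real.norm_eq_abs, abs_of_nonneg (a := |u x| ^ s) (by positivity)]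
    have := Real.rpow_le_rpow (abs_nonneg _) hx hs
    gcongr
  linarith

/-- The two identities that define the degenerate part of the Nehari manifold, together with the
embedding inequalities, bound the parameter from below. -/
lemma exists_pos_forall_le_parameter {p q r γ c M V : ℝ} (hp : 1 < p) (hpq : p < q) (hqr : q < r)
    (hγ₀ : 0 < γ) (hc : 0 ≤ c) (hM : 0 ≤ M) (hV : 0 ≤ V) :
    ∃ L : ℝ, 0 < L ∧ ∀ P Q A R lam : ℝ, 0 < P → 0 ≤ Q → 0 < lam →
      A ≤ M * (c * P ^ (1 / p)) ^ (1 - γ) → R ≤ (c * P ^ (1 / p)) ^ r * V →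
      P + Q = A + lam * R →
      (p + γ - 1) * P + (q + γ - 1) * Q = lam * (r + γ - 1) * R → L ≤ lam := by
  have h1 : 0 < p + γ - 1 := by linarith
  have h2 : 0 < r + γ - 1 := by linarith
  have h3 : 0 < r - p := by linarith
  set E := (r + γ - 1) * M * c ^ (1 - γ) / (r - p) with hE
  have hE0 : 0 ≤ E := by positivity
  set Y := E ^ (1 / (p + γ - 1)) with hY
  set B := (r + γ - 1) * c ^ r * V * Y ^ (r - p) with hB
  have hB0 : 0 ≤ B := by positivity
  -- The argument yields `p + γ - 1 ≤ lam * B`; the `+ 1` covers the case `B = 0`.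
  refine ⟨(p + γ - 1) / (B + 1), by positivity, ?_⟩
  intro P Q A R lam hP hQ hlam hA hR hN hN0
  set y := P ^ (1 / p) with hy
  have hy0 : 0 < y := by positivity
  have hPy : P = y ^ p := by
    rw [hy, ← Real.rpow_mul hP.le, one_div_mul_cancel (by linarith), Real.rpow_one]
  rw [Real.mul_rpow hc hy0.le] at hA hR
  -- Upper bound on `P = y ^ p`: eliminate `lam * R`, drop the `Q` term by `q < r`, and divide by `y
  -- ^ (1 - γ)`.
  have hyE : y ^ (p + γ - 1) ≤ E := by
    have e1 : (r - p) * P ≤ (r + γ - 1) * A := by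
      have : 0 ≤ (r - q) * Q := mul_nonneg (by linarith) hQ
      have e : (r + γ - 1) * A = (r - p) * P + (r - q) * Q := by
        linear_combination -(r + γ - 1) * hN + hN0
      linarith
    have e2 := e1.trans (mul_le_mul_of_nonneg_left hA h2.le)
    have e3 : P = y ^ (p + γ - 1) * y ^ (1 - γ) := by
      rw [hPy, ← Real.rpow_add hy0]
      congr 1
      ring
    have hyγ : 0 < y ^ (1 - γ) := by positivity
    rw [hE, le_div_iff₀ h3]
    rw [e3] at e2
    refine le_of_mul_le_mul_right ?_ hyγ
    linarith
  have hyY : y ≤ Y := by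
    have := Real.rpow_le_rpow (by positivity) hyE (by positivity : 0 ≤ 1 / (p + γ - 1))
    rwa [← Real.rpow_mul hy0.le, mul_one_div_cancel h1.ne', Real.rpow_one] at this
  -- The second identity without its `Q` term, divided by `P`; the remaining `y ^ (r - p)` is at
  -- most `Y ^ (r - p)` because `r > p`.
  have hfin : p + γ - 1 ≤ lam * B := by
    have e1 : (p + γ - 1) * P ≤ lam * (r + γ - 1) * R := by
      have : 0 ≤ (q + γ - 1) * Q := mul_nonneg (by linarith) hQ
      linarith
    have e2 := e1.trans (mul_le_mul_of_nonneg_left hR (by positivity))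
    have e3 : y ^ r = y ^ (r - p) * P := by
      rw [hPy, ← Real.rpow_add hy0, sub_add_cancel]
    rw [e3] at e2
    have e4 : p + γ - 1 ≤ lam * ((r + γ - 1) * c ^ r * V * y ^ (r - p)) := by
      refine le_of_mul_le_mul_right ?_ hP
      linarith
    refine e4.trans ?_
    rw [hB]
    gcongr
  rw [div_le_iff₀ (by positivity)]
  linarith

end DoublePhase

end

theorem proposition3p3
    (T : ℝ) (hT : 0 < T)
    (α β p q r γ : ℝ)
    (hα₀ : 1 / p < α) (hα₁ : α < 1) (hβ₀ : 0 ≤ β) (hβ₁ : β ≤ 1)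
    (ψ : ℝ → ℝ) (hψ : ContDiffOn ℝ 1 ψ (Set.Icc 0 T)) (hψ_mono : StrictMonoOn ψ (Set.Icc 0 T))
    (hψ' : ∀ x ∈ Set.Icc 0 T, derivWithin ψ (Set.Icc 0 T) x ≠ 0)
    (hp₁ : 1 < p) (hp₂ : p < 2) (hpq : p < q) (hq : q < DoublePhase.critExp α p)
    (μ : ℝ × ℝ → ℝ) (hμ : MeasureTheory.MemLp μ ⊤ (DoublePhase.vol T))
    (hμ₀ : ∀ᵐ x ∂(DoublePhase.vol T), 0 ≤ μ x)
    (hγ₀ : 0 < γ) (hγ₁ : γ < 1) (hqr : q < r) (hr : r < DoublePhase.critExp α p)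
    (a : ℝ × ℝ → ℝ) (ha : MeasureTheory.MemLp a ⊤ (DoublePhase.vol T))
    (ha₀ : ∀ᵐ x ∂(DoublePhase.vol T), 0 < a x) :
    ∃ lamStar : ℝ, 0 < lamStar ∧ ∀ lam : ℝ, 0 < lam → lam < lamStar →
      DoublePhase.nehariZero T α β p q r γ ψ μ a lam = ∅ := by
  have H := DoublePhase.isClock_of_contDiffOn hT hψ hψ_mono hψ'
  have hp0 : 0 < p := by linarith
  obtain ⟨c, hc, hemb⟩ := H.exists_ae_abs_le (q := q) hp₁ hα₀ hα₁ hβ₀ hβ₁ hμ₀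
  obtain ⟨M, hM, hMle⟩ := DoublePhase.exists_weightedNormPow_le ha
  obtain ⟨L, hL, hLle⟩ := DoublePhase.exists_pos_forall_le_parameter (V := (DoublePhase.vol T).real
    Set.univ) hp₁ hpq hqr hγ₀ hc hM measureReal_nonneg
  refine ⟨L, hL, fun lam hlam hlt => Set.eq_empty_iff_forall_notMem.2 ?_⟩
  rintro u ⟨⟨huF, hu0, hN⟩, hN0⟩
  -- The embedding holds for every admissible pair, so the choice made in `hilferD` is immaterial.
  have hD : DoublePhase.HasHilferDeriv T α β p q ψ μ u
      (DoublePhase.hilferD T α β p q ψ μ u) := by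
    have hex : ∃ v, DoublePhase.HasHilferDeriv T α β p q ψ μ u v := huF
    rw [DoublePhase.hilferD, dif_pos hex]
    exact hex.choose_spec
  have hb := hemb _ _ hD
  set v := DoublePhase.hilferD T α β p q ψ μ u
  have hP : 0 ≤ DoublePhase.normPow T p v := integral_nonneg fun _ => by positivity
  have hQ : 0 ≤ DoublePhase.weightedNormPow T q μ v :=
    integral_nonneg_of_ae (hμ₀.mono fun x hx => mul_nonneg hx (by positivity))
  -- If the `p`-term vanished, the embedding would force `u = 0` almost everywhere.
  rcases hP.eq_or_lt with hP0 | hP0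
  · refine hu0 (hb.mono fun x hx => ?_)
    rw [← hP0, Real.zero_rpow (by positivity), mul_zero] at hx
    exact abs_nonpos_iff.1 hx
  · refine hlt.not_ge (hLle _ _ _ _ lam hP0 hQ hlam (hMle (1 - γ) _ (by linarith) u hb)
      (DoublePhase.normPow_le (by linarith) hb) hN hN0)
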